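/- The multiple gamma functions $\Gamma_1,\Gamma_2,\dots$ are the unique sequence of meromorphic functions on $\mathbb{C}$, without zeros (so that each $1/\Gamma_m$ is entire) and positive on $(0,\infty)$, such that $\Gamma_1=\Gamma$ is the Euler gamma function and, for all $m\ge 1$, $$\Gamma_{m+1}(z+1)=\frac{\Gamma_{m+1}(z)}{\Gamma_m(z)}\quad (z\in\mathbb{C}\setminus\{0,-1,-2,\dots\}),\qquad \Gamma_m(1)=1,\qquad (-1)^{m+1}\frac{d^{m+1}}{dx^{m+1}}\log\Gamma_m(x)\ge 0\quad (x>0);$$ such a sequence exists and is unique. For $\Re(w)>0$ let $\log\Gamma_m(w)$ be the holomorphic branch of the logarithm on the right half-plane with $\log\Gamma_m(1)=0$, and let $\log$ and $\arctan$ of other arguments be the principal branches. Let $H_p=\sum_{k=1}^p 1/k$, let $\zeta'$ be the derivative of the Riemann zeta function, and let ${p \brace k}$ be the Stirling subset numbers, i.e. ${p \brace k}=k{p-1 \brace k}+{p-1 \brace k-1}$ for $p,k\ge1$, with ${p\brace 0}=1$ if $p=0$ and $0$ otherwise, and ${0\brace k}=0$ for $k\ge 1$. Then for every integer $n\ge 1$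 and every $z\in\mathbb{C}$ with $\Re(z)>0$ the two integrals below converge absolutely, and $$\begin{aligned}(2n)!\,\log\Gamma_{2n+1}(z+1)={}&\frac{z^{2n+1}(\log z-H_{2n+1})}{2n+1}-\sum_{k=0}^{2n}(-1)^k\binom{2n}{k}\zeta'(-k)\,z^{2n-k}\\&-\sum_{k=1}^{2n-1}(-1)^k\,k!\,{2n \brace k}\log\Gamma_{k+1}(z+1)+2(-1)^n\int_0^\infty\frac{x^{2n}\arctan(x/z)}{e^{2\pi x}-1}\,dx\end{aligned}$$ and $$\begin{aligned}(2n-1)!\,\log\Gamma_{2n}(z+1)={}&-\frac{z^{2n}(\log z-H_{2n})}{2n}+\sum_{k=0}^{2n-1}(-1)^k\binom{2n-1}{k}\zeta'(-k)\,z^{2n-k-1}\\&+\sum_{k=1}^{2n-2}(-1)^k\,k!\,{2n-1 \brace k}\log\Gamma_{k+1}(z+1)-(-1)^n\int_0^\infty\frac{x^{2n-1}\log(x^2+z^2)}{e^{2\pi x}-1}\,dx.\end{aligned}$$ -/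

import Mathlib

/-- The system that defines the multiple gamma functions `Γ₁, Γ₂, …` (`Γ 0` is unconstrained).
A pole of `Γ n` carries the value `0`, as for `Complex.Gamma`, and meromorphy together with the
absence of zeros is expressed by `1 / Γ n` being entire. -/
structure IsMultipleGamma (Γ : ℕ → ℂ → ℂ) : Prop where
  /-- `Γ₁` is the Euler gamma function. -/
  one : Γ 1 = Complex.Gamma
  /-- `Γ n` is meromorphic on `ℂ`, with `1 / Γ n` entire. -/
  entire_inv : ∀ n : ℕ, 1 ≤ n → Differentiable ℂ (fun z : ℂ => (Γ n z)⁻¹)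
  /-- The recurrence-functional equation, away from the poles at the nonpositive integers. -/
  functional_equation : ∀ n : ℕ, 1 ≤ n → ∀ z : ℂ, (∀ k : ℕ, z ≠ -(k : ℂ)) →
    Γ (n + 1) (z + 1) = Γ (n + 1) z / Γ n z
  /-- The normalization `Γ n (1) = 1`. -/
  map_one : ∀ n : ℕ, 1 ≤ n → Γ n 1 = 1
  /-- `Γ n` is real and positive on the positive half-line, so that its real logarithm exists. -/
  pos : ∀ n : ℕ, 1 ≤ n → ∀ x : ℝ, 0 < x → (Γ n (x : ℂ)).im = 0 ∧ 0 < (Γ n (x : ℂ)).re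
  /-- The convexity condition `(-1)^(n+1) (d/dx)^(n+1) log Γ n (x) ≥ 0` for `x > 0`. -/
  convexity : ∀ n : ℕ, 1 ≤ n → ∀ x : ℝ, 0 < x →
    0 ≤ (-1 : ℝ) ^ (n + 1) *
      iteratedDeriv (n + 1) (fun y : ℝ => Real.log (Γ n (y : ℂ)).re) x

/-- The multiple gamma function `Γ_n`, `n ≥ 1`: the solution of the system `IsMultipleGamma`. -/
noncomputable def multipleGamma : ℕ → ℂ → ℂ :=
  Classical.epsilon IsMultipleGamma

/-- `log Γ_n (w)` for `Re w > 0`: the holomorphic branch of the logarithm of `Γ_n` on the right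
half-plane that vanishes at `w = 1` (equivalently, is real on the positive half-line), obtained by
integrating `Γ_n' / Γ_n` along the segment from `1` to `w`. -/
noncomputable def logMultipleGamma (n : ℕ) (w : ℂ) : ℂ :=
  ∫ t in (0 : ℝ)..1, (w - 1) * logDeriv (multipleGamma n) (1 + (t : ℂ) * (w - 1))

/-!
The idea is that `log Γ_{k + 1} (z + 1)` is a regularized value of the divergent sum
`-∑_{j ≥ 1} (j + k - 1 choose k) log (z + j)`. Expanding `(-j) ^ p` in binomial coefficients, which
brings in the Stirling subset numbers, turns a combination of the `log Γ_{k + 1} (z + 1)`, `k ≤ p`,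
into a regularization of `-∑_{j ≥ 1} (-j) ^ p log (z + j)`, and the Abel-Plana formula evaluates the
latter: its correction term is, up to a power of `i`, the integral of
`x ^ p (log (z + i x) ± log (z - i x)) / (exp (2 π x) - 1)`, that is, an integral with
`arctan (x / z)` if `p` is even and with `log (x ^ 2 + z ^ 2)` if `p` is odd.

The regularization is by analytic continuation. Minus the derivative at `s = 0` of
`∑_{j ≥ 1} j ^ p (z + j) ^ (-s)` is `logSum p z`; a closed form comes from the Lipschitz formula for
`∑ j ^ p exp (-j t)` (`hasSum_pow_mul_exp_neg`) by a Mellin transform (`shiftedSeries_eq`). For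
`p = 0`, where the Lipschitz series does not converge absolutely, the kernel of Binet's formula is
used instead (`shiftedSeries_zero_eq`). Since the continuation is unique, the shift `z ↦ z + 1` and the
value at `z = 1` can be read off from the Dirichlet series (`logSum_rec`, `logSum_one`); the values
`ζ'(-k)` enter here. A polynomial correction normalizes the sums to vanish at `z = 1`
(`normalizedLogSum`), and their binomial combinations `chooseLogSum` satisfy the difference
equations of the `log Γ_{k + 1} (z + 1)`. Their partial sums define `logGamma N`.

That `exp (logGamma N)` is `Γ_N` rests on growth. The closed form shows that `logGamma N` is
`O(‖z‖ ^ (N + 1 / 2))` on `1 ≤ re z`, so by the Cauchy estimates its derivatives of order greater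
than `N` tend to `0` along the real axis. With the difference equation this gives the sign condition
(`iteratedDeriv_logGamma_nonneg`) by induction on `N`, reality on the positive half-line
(`logGamma_ofReal`), and, together with the Bohr-Mollerup theorem, `Γ₁ = Γ` (`exp_logGamma_one_eq`).
The functional equation continues `exp (-logGamma N)` to an entire function. Uniqueness follows the
same pattern: the derivatives of order `N` of two solutions are, up to the same sign, increasing
with equal differences that tend to `0`, hence they differ by a constant (`exists_sub_eq_const`);
the difference of the solutions is periodic with a constant derivative of order `N`, hence constant
(`PeriodicOnPos.const_of_iteratedDeriv_const`).
-/

open Complex Set Filter Topology MeasureTheory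

/-! ### Differentiation of parameter integrals and analytic continuation -/

/-- Differentiation under the integral sign for a holomorphic integrand that is locally dominated:
by the Cauchy estimates no bound on the derivative is needed. -/
theorem hasDerivAt_integral_of_holomorphic {α : Type*} [MeasurableSpace α] {μ : Measure α}
    {f : ℂ → α → ℂ} {g : α → ℝ} {z₀ : ℂ} {r : ℝ} (hr : 0 < r)
    (hm : ∀ z ∈ Metric.ball z₀ r, AEStronglyMeasurable (f z) μ)
    (hd : ∀ᵐ x ∂μ, DifferentiableOn ℂ (fun z => f z x) (Metric.ball z₀ r))
    (hb : ∀ᵐ x ∂μ, ∀ z ∈ Metric.ball z₀ r, ‖f z x‖ ≤ g x) (hg : Integrable g μ) :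
    Integrable (fun x => deriv (fun z => f z x) z₀) μ ∧
    HasDerivAt (fun z => ∫ x, f z x ∂μ) (∫ x, deriv (fun z => f z x) z₀ ∂μ) z₀ := by
  have hball : ∀ z ∈ Metric.ball z₀ (r / 2), Metric.closedBall z (r / 4) ⊆ Metric.ball z₀ r := by
    intro z hz w hw
    simp only [Metric.mem_ball, Metric.mem_closedBall] at *
    linarith [dist_triangle w z z₀]
  have hz₀ : z₀ ∈ Metric.ball z₀ r := Metric.mem_ball_self hr
  refine hasDerivAt_integral_of_dominated_loc_of_deriv_le (s := Metric.ball z₀ (r / 2))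
    (F' := fun z x => deriv (fun z => f z x) z) (bound := fun x => g x / (r / 4))
    (Metric.ball_mem_nhds _ (by positivity)) ?_ ?_ ?_ ?_ (hg.div_const _) ?_
  · filter_upwards [Metric.ball_mem_nhds z₀ hr] with z hz using hm z hz
  · exact hg.mono' (hm z₀ hz₀) (hb.mono fun x hx => hx z₀ hz₀)
  · -- the derivative is a limit of difference quotients
    have hlim : Tendsto (fun n : ℕ => ((r / 2 * (1 / ((n : ℝ) + 1)) : ℝ) : ℂ)) atTop (𝓝[≠] 0) := by
      rw [tendsto_nhdsWithin_iff]
      constructor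
      · have h := (tendsto_one_div_add_atTop_nhds_zero_nat (𝕜 := ℝ)).const_mul (r / 2)
        rw [mul_zero] at h
        exact (Complex.continuous_ofReal.tendsto' 0 0 (by simp)).comp h
      · refine Eventually.of_forall fun n => ?_
        have : (0 : ℝ) < r / 2 * (1 / ((n : ℝ) + 1)) := by positivity
        simpa only [mem_compl_iff, mem_singleton_iff, ofReal_eq_zero] using this.ne'
    refine aestronglyMeasurable_of_tendsto_ae atTop (f := fun (n : ℕ) x =>
      ((r / 2 * (1 / ((n : ℝ) + 1)) : ℝ) : ℂ)⁻¹ •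
        (f (z₀ + ((r / 2 * (1 / ((n : ℝ) + 1)) : ℝ) : ℂ)) x - f z₀ x)) ?_ ?_
    · intro n
      suffices hmem : z₀ + ((r / 2 * (1 / ((n : ℝ) + 1)) : ℝ) : ℂ) ∈ Metric.ball z₀ r from
        ((hm _ hmem).sub (hm _ hz₀)).const_smul ((r / 2 * (1 / ((n : ℝ) + 1)) : ℝ) : ℂ)⁻¹
      have h0 : (0 : ℝ) < r / 2 * (1 / ((n : ℝ) + 1)) := by positivity
      rw [Metric.mem_ball, dist_eq, add_sub_cancel_left, norm_real, Real.norm_of_nonneg h0.le]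
      have h1 : 1 / ((n : ℝ) + 1) ≤ 1 := by
        rw [div_le_one (by positivity)]; linarith [n.cast_nonneg (α := ℝ)]
      nlinarith
    · filter_upwards [hd] with x hx
      have h := ((hx.differentiableAt (Metric.ball_mem_nhds z₀ hr)).hasDerivAt).tendsto_slope_zero
      exact h.comp hlim
  · filter_upwards [hd, hb] with x hx hbx z hz
    refine Complex.norm_deriv_le_of_forall_mem_sphere_norm_le (by positivity) ?_ ?_
    · exact (hx.mono (hball z hz)).diffContOnCl_ball Subset.rfl
    · exact fun w hw => hbx w (hball z hz (Metric.sphere_subset_closedBall hw))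
  · filter_upwards [hd] with x hx z hz
    exact (hx.differentiableAt (Metric.isOpen_ball.mem_nhds
      (Metric.ball_subset_ball (by linarith) hz))).hasDerivAt

theorem isOpen_re_pos : IsOpen {z : ℂ | 0 < z.re} := isOpen_lt continuous_const continuous_re

theorem eqOn_re_pos_of_forall_ofReal {f g : ℂ → ℂ} (hf : DifferentiableOn ℂ f {z | 0 < z.re})
    (hg : DifferentiableOn ℂ g {z | 0 < z.re}) (h : ∀ x : ℝ, 0 < x → f x = g x) :
    EqOn f g {z | 0 < z.re} := by
  refine (hf.analyticOnNhd isOpen_re_pos).eqOn_of_preconnected_of_frequently_eq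
    (hg.analyticOnNhd isOpen_re_pos) (convex_halfSpace_re_gt 0).isPreconnected
    (z₀ := 1) (by simp) ?_
  have hlim : Tendsto (fun n : ℕ => ((1 + 1 / ((n : ℝ) + 1) : ℝ) : ℂ)) atTop (𝓝[≠] 1) := by
    rw [tendsto_nhdsWithin_iff]
    constructor
    · have h := (tendsto_one_div_add_atTop_nhds_zero_nat (𝕜 := ℝ)).const_add 1
      exact (Complex.continuous_ofReal.tendsto' (1 + 0) 1 (by simp)).comp h
    · refine Eventually.of_forall fun n => ?_
      have : (0 : ℝ) < 1 / ((n : ℝ) + 1) := by positivity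
      simp only [mem_compl_iff, mem_singleton_iff, ofReal_eq_one]
      linarith
  exact hlim.frequently (Eventually.frequently (Eventually.of_forall fun n => h _ (by positivity)))

/-- A domain around `0` that avoids the poles `1, 2, …` of the Dirichlet series below and meets
every right half-plane. -/
def continuationDomain : Set ℂ := {s | -1 < s.re ∧ (0 < s.im ∨ s.re < 1)}

theorem isOpen_continuationDomain : IsOpen continuationDomain :=
  (isOpen_lt continuous_const continuous_re).inter
    ((isOpen_lt continuous_const continuous_im).union (isOpen_lt continuous_re continuous_const))

theorem zero_mem_continuationDomain : (0 : ℂ) ∈ continuationDomain := by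
  simp [continuationDomain]

theorem isPreconnected_continuationDomain : IsPreconnected continuationDomain := by
  have h : continuationDomain = {s | -1 < s.re} ∩ {s | 0 < s.im} ∪ {s | -1 < s.re} ∩ {s | s.re < 1} := by
    ext s; simp [continuationDomain, and_or_left]
  rw [h]
  refine IsPreconnected.union I (by simp) (by simp) ?_ ?_
  · exact ((convex_halfSpace_re_gt _).inter (convex_halfSpace_im_gt _)).isPreconnected
  · exact ((convex_halfSpace_re_gt _).inter (convex_halfSpace_re_lt _)).isPreconnected

theorem sub_natCast_succ_ne_zero {s : ℂ} (hs : s ∈ continuationDomain) (k : ℕ) :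
    s - (k + 1) ≠ 0 := by
  intro h
  rw [sub_eq_zero] at h
  subst h
  simp [continuationDomain] at hs
  linarith [k.cast_nonneg (α := ℝ), hs.2]

/-- Holomorphic functions on the domain that agree in a right half-plane are equal. -/
theorem eqOn_continuationDomain {f g : ℂ → ℂ} (hf : DifferentiableOn ℂ f continuationDomain)
    (hg : DifferentiableOn ℂ g continuationDomain) {c : ℝ}
    (h : ∀ s : ℂ, s ∈ continuationDomain → c < s.re → f s = g s) :
    EqOn f g continuationDomain := by
  have hmem : ((|c| + 1 : ℝ) : ℂ) + I ∈ continuationDomain := by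
    simp only [continuationDomain, mem_ofPred_eq, add_re, ofReal_re, I_re, add_zero, add_im,
      ofReal_im, I_im, zero_add, zero_lt_one, true_or, and_true]
    linarith [abs_nonneg c]
  refine (hf.analyticOnNhd isOpen_continuationDomain).eqOn_of_preconnected_of_eventuallyEq
    (hg.analyticOnNhd isOpen_continuationDomain) isPreconnected_continuationDomain hmem ?_
  have hopen : IsOpen {s : ℂ | c < s.re} := isOpen_lt continuous_const continuous_re
  filter_upwards [isOpen_continuationDomain.mem_nhds hmem, hopen.mem_nhds (x := ((|c| + 1 : ℝ) : ℂ) + I)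
    (by simp; linarith [le_abs_self c])] with s h1 h2 using h s h1 h2

theorem integrableOn_cpow_mul_exp_neg_mul {a : ℂ} {r : ℝ} (ha : 0 < a.re) (hr : 0 < r) :
    IntegrableOn (fun t : ℝ => ‖(t : ℂ) ^ (a - 1)‖ * Real.exp (-(r * t))) (Ioi 0) := by
  have h := integrableOn_rpow_mul_exp_neg_mul_rpow (s := a.re - 1) (p := 1) (b := r) (by linarith)
    zero_lt_one hr
  refine h.congr_fun (fun t ht => ?_) measurableSet_Ioi
  simp [norm_cpow_eq_rpow_re_of_pos ht]

theorem norm_exp_neg_mul_ofReal (r : ℂ) (t : ℝ) : ‖exp (-(r * t))‖ = Real.exp (-(r.re * t)) := by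
  rw [norm_exp]; simp

/-- Euler's integral `∫ t^(a-1) exp (-r t) dt = r^(-a) Γ(a)` for complex `r` with `0 < re r`, by
analytic continuation in `r`. -/
theorem integral_cpow_mul_exp_neg_mul_Ioi_of_re_pos {a r : ℂ} (ha : 0 < a.re) (hr : 0 < r.re) :
    ∫ t : ℝ in Ioi 0, (t : ℂ) ^ (a - 1) * exp (-(r * t)) = r ^ (-a) * Gamma a := by
  have hmeas : ∀ r : ℂ, AEStronglyMeasurable (fun t : ℝ => (t : ℂ) ^ (a - 1) * exp (-(r * t)))
      (volume.restrict (Ioi 0)) := by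
    intro r
    refine ContinuousOn.aestronglyMeasurable (fun t ht => ?_) measurableSet_Ioi
    refine ContinuousAt.continuousWithinAt (ContinuousAt.mul ?_ (by fun_prop))
    exact (continuousAt_ofReal_cpow_const _ _ (Or.inr (ne_of_gt ht)))
  refine eqOn_re_pos_of_forall_ofReal (f := fun r : ℂ =>
    ∫ t : ℝ in Ioi 0, (t : ℂ) ^ (a - 1) * exp (-(r * t))) (g := fun r => r ^ (-a) * Gamma a)
    ?_ ?_ ?_ hr
  · intro z hz
    have hz' : 0 < z.re := hz
    refine (hasDerivAt_integral_of_holomorphic (r := z.re / 2) (by positivity)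
      (g := fun t : ℝ => ‖(t : ℂ) ^ (a - 1)‖ * Real.exp (-(z.re / 2 * t))) (fun w _ => hmeas w) ?_ ?_
      (integrableOn_cpow_mul_exp_neg_mul ha (by positivity))).2.differentiableAt.differentiableWithinAt
    · exact Eventually.of_forall fun t => Differentiable.differentiableOn (by fun_prop)
    · refine (ae_restrict_iff' measurableSet_Ioi).2 (Eventually.of_forall fun t ht w hw => ?_)
      rw [norm_mul, norm_exp_neg_mul_ofReal]
      have h1 : |(w - z).re| < z.re / 2 := (abs_re_le_norm _).trans_lt (by simpa [dist_eq] using hw)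
      rw [sub_re, abs_lt] at h1
      have ht' : (0 : ℝ) < t := ht
      gcongr
      linarith [h1.1]
  · intro z hz
    refine DifferentiableAt.differentiableWithinAt (DifferentiableAt.mul_const ?_ _)
    exact (differentiableAt_id).cpow (by fun_prop) (Or.inl hz)
  · intro x hx
    rw [integral_cpow_mul_exp_neg_mul_Ioi ha hx, one_div, inv_cpow, cpow_neg]
    rw [arg_ofReal_of_nonneg hx.le]; exact Real.pi_pos.ne

/-! ### The Abel-Plana formula for exponential sums -/

/-- The integrand of the Abel-Plana correction term of the series `∑ j ^ p φ(j)`. -/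
noncomputable def planaIntegrand (p : ℕ) (φ : ℂ → ℂ) (x : ℝ) : ℂ :=
  ((I * x) ^ p * φ (I * x) - (-(I * x)) ^ p * φ (-(I * x))) / (exp (2 * Real.pi * x) - 1)

/-- The Abel-Plana correction term of the series `∑ j ^ p φ(j)`. -/
noncomputable def planaIntegral (p : ℕ) (φ : ℂ → ℂ) : ℂ :=
  I * ∫ x in Ioi (0 : ℝ), planaIntegrand p φ x

theorem norm_exp_two_pi_sub_one {x : ℝ} (hx : 0 < x) :
    ‖exp (2 * Real.pi * x) - 1‖ = Real.exp (2 * Real.pi * x) - 1 := by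
  have h : exp (2 * Real.pi * x) - 1 = ((Real.exp (2 * Real.pi * x) - 1 : ℝ) : ℂ) := by
    push_cast; ring
  rw [h, norm_real, Real.norm_of_nonneg]
  rw [sub_nonneg, Real.one_le_exp_iff]
  positivity

theorem exp_two_pi_sub_one_ne_zero {x : ℝ} (hx : 0 < x) : exp (2 * Real.pi * x) - 1 ≠ 0 := by
  rw [← norm_ne_zero_iff, norm_exp_two_pi_sub_one hx]
  have : 1 < Real.exp (2 * Real.pi * x) := Real.one_lt_exp_iff.2 (by positivity)
  linarith

theorem mul_exp_pi_le_norm {x : ℝ} (hx : 0 < x) :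
    x * Real.exp (Real.pi * x) ≤ ‖exp (2 * Real.pi * x) - 1‖ := by
  rw [norm_exp_two_pi_sub_one hx, show 2 * Real.pi * x = Real.pi * x + Real.pi * x by ring,
    Real.exp_add]
  have h1 := Real.add_one_le_exp (Real.pi * x)
  have h2 : x ≤ Real.pi * x := by nlinarith [Real.pi_gt_three]
  nlinarith [Real.exp_pos (Real.pi * x)]

theorem norm_pow_div_le {p : ℕ} (hp : 1 ≤ p) {x : ℝ} (hx : 0 < x) {u a : ℂ} (hu : ‖u‖ = x) {c : ℝ}
    (ha : ‖a‖ ≤ c) :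
    ‖u ^ p * a / (exp (2 * Real.pi * x) - 1)‖ ≤ c * ((1 + x) ^ p * Real.exp (-(Real.pi * x))) := by
  rw [norm_div, norm_mul, norm_pow, hu]
  have h := mul_exp_pi_le_norm hx
  have hc : 0 ≤ c := (norm_nonneg _).trans ha
  rw [div_le_iff₀ (lt_of_lt_of_le (by positivity) h)]
  obtain ⟨q, rfl⟩ := Nat.exists_eq_add_of_le hp
  have h1 : x ^ q ≤ (1 + x) ^ (1 + q) :=
    (pow_le_pow_left₀ hx.le (by linarith) q).trans (pow_le_pow_right₀ (by linarith) (by lia))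
  calc x ^ (1 + q) * ‖a‖ ≤ x ^ (1 + q) * c := by gcongr
    _ = c * (x ^ q * Real.exp (-(Real.pi * x))) * (x * Real.exp (Real.pi * x)) := by
        have : Real.exp (-(Real.pi * x)) * Real.exp (Real.pi * x) = 1 := by
          rw [← Real.exp_add]; simp
        linear_combination (-(c * x ^ q * x)) * this
    _ ≤ _ := by gcongr

theorem norm_planaIntegrand_le {p : ℕ} (hp : 1 ≤ p) {φ : ℂ → ℂ} {x : ℝ} (hx : 0 < x) {c : ℝ}
    (h1 : ‖φ (I * x)‖ ≤ c) (h2 : ‖φ (-(I * x))‖ ≤ c) :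
    ‖planaIntegrand p φ x‖ ≤ 2 * c * ((1 + x) ^ p * Real.exp (-(Real.pi * x))) := by
  rw [planaIntegrand, sub_div]
  have e1 := norm_pow_div_le hp hx (u := I * x) (by simp [hx.le]) h1
  have e2 := norm_pow_div_le hp hx (u := -(I * x)) (by simp [hx.le]) h2
  linarith [norm_sub_le ((I * x) ^ p * φ (I * x) / (exp (2 * Real.pi * x) - 1))
    ((-(I * x)) ^ p * φ (-(I * x)) / (exp (2 * Real.pi * x) - 1))]

theorem integrableOn_one_add_pow_mul_exp (M : ℕ) :
    IntegrableOn (fun x : ℝ => (1 + x) ^ M * Real.exp (-(Real.pi * x))) (Ioi 0) := by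
  have h := (integrableOn_exp_neg_Ioi 0).const_mul (M.factorial * Real.exp 1)
  refine h.mono' (by fun_prop) ((ae_restrict_iff' measurableSet_Ioi).2
    (Eventually.of_forall fun x hx => ?_))
  have hx' : (0 : ℝ) < x := hx
  rw [Real.norm_of_nonneg (by positivity)]
  have h1 := Real.pow_div_factorial_le_exp (1 + x) (by positivity) M
  rw [div_le_iff₀ (by positivity)] at h1
  have h2 : Real.exp (-(Real.pi * x)) ≤ Real.exp (-(2 * x)) := by
    gcongr; linarith [Real.pi_gt_three]
  calc (1 + x) ^ M * Real.exp (-(Real.pi * x))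
      ≤ (Real.exp (1 + x) * M.factorial) * Real.exp (-(2 * x)) := by gcongr
    _ = M.factorial * Real.exp 1 * Real.exp (-x) := by
      rw [show -x = x + -(2 * x) by ring, Real.exp_add, Real.exp_add]; ring

theorem aestronglyMeasurable_planaIntegrand (p : ℕ) {φ : ℂ → ℂ}
    (h : ∀ x : ℝ, ContinuousAt φ (I * x)) :
    AEStronglyMeasurable (planaIntegrand p φ) (volume.restrict (Ioi 0)) := by
  refine ContinuousOn.aestronglyMeasurable (fun x hx => ?_) measurableSet_Ioi
  refine ContinuousAt.continuousWithinAt (ContinuousAt.div ?_ (by fun_prop)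
    (exp_two_pi_sub_one_ne_zero hx))
  refine ContinuousAt.sub (ContinuousAt.mul (by fun_prop) ?_) (ContinuousAt.mul (by fun_prop) ?_)
  · exact ContinuousAt.comp (f := fun x : ℝ => I * (x : ℂ)) (h x) (by fun_prop)
  · have h' := h (-x)
    refine ContinuousAt.comp (f := fun x : ℝ => -(I * (x : ℂ))) ?_ (by fun_prop)
    simpa using h'

theorem integrableOn_planaIntegrand {p : ℕ} (hp : 1 ≤ p) {φ : ℂ → ℂ}
    (h : ∀ x : ℝ, ContinuousAt φ (I * x)) {c : ℝ} {M : ℕ}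
    (hb : ∀ x : ℝ, ‖φ (I * x)‖ ≤ c * (1 + |x|) ^ M) :
    IntegrableOn (planaIntegrand p φ) (Ioi 0) := by
  refine ((integrableOn_one_add_pow_mul_exp (M + p)).const_mul (2 * c)).mono'
    (aestronglyMeasurable_planaIntegrand p h) ((ae_restrict_iff' measurableSet_Ioi).2
    (Eventually.of_forall fun x hx => ?_))
  have hx' : (0 : ℝ) < x := hx
  refine (norm_planaIntegrand_le hp hx' (c := c * (1 + x) ^ M) ?_ ?_).trans_eq (by ring)
  · simpa [abs_of_pos hx'] using hb x
  · simpa [abs_of_pos hx'] using hb (-x)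

theorem integral_pow_mul_exp_neg_mul (p : ℕ) {r : ℂ} (hr : 0 < r.re) :
    ∫ x : ℝ in Ioi 0, (x : ℂ) ^ p * exp (-(r * x)) = p.factorial / r ^ (p + 1) := by
  have h := integral_cpow_mul_exp_neg_mul_Ioi_of_re_pos (a := p + 1) (r := r)
    (by simp; positivity) hr
  rw [Gamma_nat_eq_factorial, add_sub_cancel_right, cpow_neg] at h
  simp only [cpow_natCast] at h
  rw [h]
  norm_cast
  field_simp

theorem tsum_pow_mul_exp_neg_mul (p : ℕ) (t : ℝ) {x : ℝ} (hx : 0 < x) :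
    ∑' m : ℕ, (x : ℂ) ^ p * exp (-((2 * Real.pi * (m + 1) + I * t) * x)) =
      (x : ℂ) ^ p * exp (-(I * t * x)) / (exp (2 * Real.pi * x) - 1) := by
  have hlt : ‖exp (-(2 * Real.pi * x))‖ < 1 := by
    have : (-(2 * Real.pi * x) : ℂ).re = -(2 * Real.pi * x) := by simp
    rw [norm_exp, Real.exp_lt_one_iff, this, neg_lt_zero]
    positivity
  have hs : ∀ m : ℕ, (x : ℂ) ^ p * exp (-((2 * Real.pi * (m + 1) + I * t) * x)) =
      (x : ℂ) ^ p * exp (-(I * t * x)) *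
        (exp (-(2 * Real.pi * x)) * exp (-(2 * Real.pi * x)) ^ m) := by
    intro m
    rw [← exp_nat_mul, mul_assoc ((x : ℂ) ^ p), ← exp_add, ← exp_add]
    ring_nf
  rw [tsum_congr hs, tsum_mul_left, tsum_mul_left, tsum_geometric_of_norm_lt_one hlt, div_eq_mul_inv]
  congr 1
  rw [exp_neg]
  have h0 := exp_two_pi_sub_one_ne_zero hx
  have h1 := exp_ne_zero (2 * Real.pi * x)
  have h2 : 1 - (exp (2 * Real.pi * x))⁻¹ ≠ 0 := by
    intro h
    apply h0
    field_simp at h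
    linear_combination h
  field_simp

/-- The Laplace transform of `x ^ p / (exp (2 π x) - 1)` at `i t`, by expanding the denominator as a
geometric series. -/
theorem hasSum_integral_pow_mul_exp_div {p : ℕ} (hp : 1 ≤ p) (t : ℝ) :
    HasSum (fun m : ℕ => (p.factorial : ℂ) / (2 * Real.pi * (m + 1) + I * t) ^ (p + 1))
      (∫ x : ℝ in Ioi 0, (x : ℂ) ^ p * exp (-(I * t * x)) / (exp (2 * Real.pi * x) - 1)) := by
  have hre : ∀ m : ℕ, (2 * Real.pi * ((m : ℂ) + 1) + I * t).re = 2 * Real.pi * (m + 1) := by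
    intro m; simp
  have hpos : ∀ m : ℕ, 0 < 2 * Real.pi * ((m : ℝ) + 1) := fun m => by positivity
  have hnorm : ∀ (m : ℕ) (x : ℝ), 0 < x →
      ‖(x : ℂ) ^ p * exp (-((2 * Real.pi * (m + 1) + I * t) * x))‖ =
        x ^ ((p + 1 : ℝ) - 1) * Real.exp (-(2 * Real.pi * (m + 1) * x)) := by
    intro m x hx
    rw [norm_mul, norm_exp_neg_mul_ofReal, hre, norm_pow, norm_real, Real.norm_of_nonneg hx.le]
    simp
  have hint : ∀ m : ℕ, ∫ x : ℝ in Ioi 0, ‖(x : ℂ) ^ p *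
      exp (-((2 * Real.pi * (m + 1) + I * t) * x))‖ =
      (1 / (2 * Real.pi * (m + 1))) ^ (p + 1) * p.factorial := by
    intro m
    rw [setIntegral_congr_fun measurableSet_Ioi (fun x (hx : x ∈ Ioi (0 : ℝ)) => hnorm m x hx),
      Real.integral_rpow_mul_exp_neg_mul_Ioi (by positivity) (hpos m),
      Real.Gamma_nat_eq_factorial]
    norm_cast
  have key := hasSum_integral_of_summable_integral_norm (μ := volume.restrict (Ioi 0))
    (F := fun (m : ℕ) (x : ℝ) => (x : ℂ) ^ p *
      exp (-((2 * Real.pi * (m + 1) + I * t) * x))) ?_ ?_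
  · simp only [integral_pow_mul_exp_neg_mul p ((hpos _).trans_eq (hre _).symm)] at key
    suffices hval : (∫ x : ℝ in Ioi 0, ∑' m : ℕ,
        (x : ℂ) ^ p * exp (-((2 * Real.pi * (m + 1) + I * t) * x))) =
        ∫ x : ℝ in Ioi 0, (x : ℂ) ^ p * exp (-(I * t * x)) / (exp (2 * Real.pi * x) - 1) by
      rw [hval] at key
      exact key
    exact setIntegral_congr_fun measurableSet_Ioi fun x hx => tsum_pow_mul_exp_neg_mul p t hx
  · intro m
    refine Integrable.mono' (g := fun x : ℝ =>
      ‖(x : ℂ) ^ (((p : ℂ) + 1) - 1)‖ * Real.exp (-(2 * Real.pi * (m + 1) * x)))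
      (integrableOn_cpow_mul_exp_neg_mul (by simp; positivity) (hpos m)) (by fun_prop)
      ((ae_restrict_iff' measurableSet_Ioi).2 (Eventually.of_forall fun x hx => ?_))
    rw [hnorm m x hx]
    simp [abs_of_pos (show (0 : ℝ) < x from hx)]
  · simp only [hint]
    refine Summable.mul_right _ ?_
    have h := ((summable_nat_add_iff 1).2 (Real.summable_one_div_nat_pow.2
      (show 1 < p + 1 by lia))).mul_left ((1 / (2 * Real.pi)) ^ (p + 1))
    refine h.congr fun m => ?_
    push_cast
    rw [one_div_pow, one_div_pow]
    field_simp
    rw [mul_pow, mul_pow]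

theorem summable_pow_mul_exp_neg (p : ℕ) {t : ℝ} (ht : 0 < t) :
    Summable fun n : ℕ => (n : ℂ) ^ p * exp (-t) ^ n := by
  refine summable_pow_mul_geometric_of_norm_lt_one p ?_
  rw [norm_exp]
  simpa using ht

/-- The Abel-Plana formula for `∑ j ^ p exp (-j t)`; this is the Lipschitz formula, with the terms
`1 / (t + 2 π i m) ^ (p + 1)`, `m ≠ 0`, expressed as Laplace integrals. -/
theorem hasSum_pow_mul_exp_neg {p : ℕ} (hp : 1 ≤ p) {t : ℝ} (ht : 0 < t) :
    HasSum (fun j : ℕ => ((j : ℂ) + 1) ^ p * exp (-(t * (j + 1))))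
      (p.factorial / (t : ℂ) ^ (p + 1) + planaIntegral p (fun w => exp (-(t * w)))) := by
  have hpi : (Real.pi : ℂ) ≠ 0 := by exact_mod_cast Real.pi_ne_zero
  have ht0 : (t : ℂ) ≠ 0 := by exact_mod_cast ht.ne'
  set A : ℝ → ℂ := fun t =>
    ∫ x : ℝ in Ioi 0, (x : ℂ) ^ p * exp (-(I * t * x)) / (exp (2 * Real.pi * x) - 1) with hA
  have hz : 0 < (I * t / (2 * Real.pi) : ℂ).im := by
    have : (I * t / (2 * Real.pi) : ℂ) = ((t / (2 * Real.pi) : ℝ) : ℂ) * I := by push_cast; ring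
    rw [this, mul_I_im, ofReal_re]
    positivity
  have hq := EisensteinSeries.qExpansion_identity hp ⟨_, hz⟩
  have hfac : (p.factorial : ℂ) ≠ 0 := by exact_mod_cast p.factorial_ne_zero
  -- the sum over the nonzero integers in terms of Laplace integrals
  have h1 : HasSum (fun m : ℕ => 1 / ((I * t / (2 * Real.pi) : ℂ) + ((m + 1 : ℤ) : ℂ)) ^ (p + 1))
      ((2 * Real.pi) ^ (p + 1) / p.factorial * A t) := by
    refine ((hasSum_integral_pow_mul_exp_div hp t).mul_left
      ((2 * Real.pi) ^ (p + 1) / p.factorial : ℂ)).congr_fun fun m => ?_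
    have : (2 * Real.pi * (m + 1) + I * t : ℂ) =
      2 * Real.pi * (I * t / (2 * Real.pi) + ((m + 1 : ℤ) : ℂ)) := by push_cast; field_simp; ring
    rw [this]
    generalize (I * t / (2 * Real.pi) + _ : ℂ) = w
    rw [mul_pow _ w]
    field_simp
  have h2 : HasSum (fun m : ℕ => 1 / ((I * t / (2 * Real.pi) : ℂ) + ((-(m + 1) : ℤ) : ℂ)) ^ (p + 1))
      ((-(2 * Real.pi)) ^ (p + 1) / p.factorial * A (-t)) := by
    refine ((hasSum_integral_pow_mul_exp_div hp (-t)).mul_left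
      ((-(2 * Real.pi)) ^ (p + 1) / p.factorial : ℂ)).congr_fun fun m => ?_
    have : (2 * Real.pi * (m + 1) + I * (-t : ℝ) : ℂ) =
      -(2 * Real.pi) * (I * t / (2 * Real.pi) + ((-(m + 1) : ℤ) : ℂ)) := by
        push_cast; field_simp; ring
    rw [this]
    generalize (I * t / (2 * Real.pi) + _ : ℂ) = w
    rw [mul_pow _ w]
    field_simp
  have h3 := (HasSum.of_add_one_of_neg_add_one
    (f := fun n : ℤ => 1 / ((I * t / (2 * Real.pi) : ℂ) + (n : ℂ)) ^ (p + 1)) h1 h2).tsum_eq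
  have hexp : exp (2 * Real.pi * I * (I * t / (2 * Real.pi))) = exp (-t) := by
    congr 1
    field_simp
    rw [I_sq]
  simp only [hexp] at hq
  rw [h3] at hq
  have hs := (summable_pow_mul_exp_neg p ht)
  have hs' := (hasSum_nat_add_iff' 1).2 hs.hasSum
  simp only [Finset.range_one, Finset.sum_singleton, Nat.cast_zero, zero_pow (show p ≠ 0 by lia),
    zero_mul, sub_zero] at hs'
  have hplana : planaIntegral p (fun w => exp (-(t * w))) =
      I * (I ^ p * A t - (-I) ^ p * A (-t)) := by
    have hbd : ∀ s : ℝ, IntegrableOn (fun x : ℝ =>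
        (x : ℂ) ^ p * exp (-(I * s * x)) / (exp (2 * Real.pi * x) - 1)) (Ioi 0) := by
      intro s
      refine (integrableOn_one_add_pow_mul_exp p).mono' ?_
        ((ae_restrict_iff' measurableSet_Ioi).2 (Eventually.of_forall fun x hx => ?_))
      · refine ContinuousOn.aestronglyMeasurable (fun x hx => ?_) measurableSet_Ioi
        exact ContinuousAt.continuousWithinAt (ContinuousAt.div (by fun_prop) (by fun_prop)
          (exp_two_pi_sub_one_ne_zero hx))
      · have hx' : (0 : ℝ) < x := hx
        refine (norm_pow_div_le hp hx' (c := 1) (by simp [hx'.le]) ?_).trans_eq (one_mul _)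
        rw [norm_exp_neg_mul_ofReal]; simp
    rw [planaIntegral, hA]
    simp only
    rw [← integral_const_mul (I ^ p), ← integral_const_mul ((-I) ^ p),
      ← integral_sub ((hbd t).const_mul (I ^ p)) ((hbd (-t)).const_mul ((-I) ^ p))]
    congr 1
    refine setIntegral_congr_fun measurableSet_Ioi fun x _ => ?_
    simp only [planaIntegrand]
    rw [show (-(t * (I * x)) : ℂ) = -(I * t * x) by ring,
      show (-(t * -(I * x)) : ℂ) = -(I * (-t : ℝ) * x) by push_cast; ring, mul_pow,
      show (-(I * x) : ℂ) = -I * x by ring, mul_pow]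
    ring
  have hval : p.factorial / (t : ℂ) ^ (p + 1) + planaIntegral p (fun w => exp (-(t * w))) =
      ∑' n : ℕ, (n : ℂ) ^ p * exp (-t) ^ n := by
    rw [hplana]
    have hq' := congrArg (fun u => (p.factorial / (-2 * Real.pi * I : ℂ) ^ (p + 1)) * u) hq
    have hne : (-2 * Real.pi * I : ℂ) ^ (p + 1) ≠ 0 := by
      apply pow_ne_zero; simp [hpi]
    have hI : ∀ n : ℕ, (I : ℂ) ^ n * (-I) ^ n = 1 := by intro n; rw [← mul_pow]; simp
    have e0 : ∀ S : ℂ, (p.factorial / (-2 * Real.pi * I : ℂ) ^ (p + 1)) *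
      ((-2 * Real.pi * I : ℂ) ^ (p + 1) / p.factorial * S) = S := by
      intro S; field_simp
    simp only [e0] at hq'
    rw [← hq']
    have e1 : (-2 * Real.pi * I : ℂ) ^ (p + 1) = (2 * Real.pi) ^ (p + 1) * (-I) ^ (p + 1) := by
      rw [← mul_pow]; ring
    have e2 : (-2 * Real.pi * I : ℂ) ^ (p + 1) = (-(2 * Real.pi)) ^ (p + 1) * I ^ (p + 1) := by
      rw [← mul_pow]; ring
    have e3 : (1 / (I * t / (2 * Real.pi) + ((0 : ℤ) : ℂ)) ^ (p + 1) : ℂ) =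
        (-2 * Real.pi * I) ^ (p + 1) / t ^ (p + 1) := by
      rw [e1, Int.cast_zero, add_zero, div_pow, mul_pow]
      have := hI (p + 1)
      have hI0 : (I : ℂ) ^ (p + 1) ≠ 0 := pow_ne_zero _ I_ne_zero
      field_simp
      linear_combination -this
    have e4 : (p.factorial / (-2 * Real.pi * I : ℂ) ^ (p + 1)) *
        ((2 * Real.pi) ^ (p + 1) / p.factorial * A t) = I ^ (p + 1) * A t := by
      rw [e1]
      have := hI (p + 1)
      have hI0 : (-I : ℂ) ^ (p + 1) ≠ 0 := pow_ne_zero _ (neg_ne_zero.2 I_ne_zero)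
      field_simp
      linear_combination -A t * this
    have e5 : (p.factorial / (-2 * Real.pi * I : ℂ) ^ (p + 1)) *
        ((-(2 * Real.pi)) ^ (p + 1) / p.factorial * A (-t)) = (-I) ^ (p + 1) * A (-t) := by
      rw [e2]
      have := hI (p + 1)
      have hI0 : (I : ℂ) ^ (p + 1) ≠ 0 := pow_ne_zero _ I_ne_zero
      have hm : (-(2 * Real.pi) : ℂ) ^ (p + 1) ≠ 0 := by apply pow_ne_zero; simp [hpi]
      field_simp
      linear_combination -A (-t) * this
    rw [mul_add, mul_add, e4, e5, e3]
    field_simp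
    ring
  rw [hval]
  refine hs'.congr_fun fun j => ?_
  rw [← exp_nat_mul]
  push_cast
  ring_nf

/-! ### The Abel-Plana formula for the Dirichlet series `∑ j ^ p (z + j) ^ (-s)` -/

/-- The Dirichlet series `∑_{j ≥ 1} j ^ p (z + j) ^ (-s)`, convergent for `0 ≤ z`, `p + 1 < re s`. -/
noncomputable def shiftedSeries (p : ℕ) (z : ℝ) (s : ℂ) : ℂ :=
  ∑' j : ℕ, ((j : ℂ) + 1) ^ p / ((z + j + 1 : ℝ) : ℂ) ^ s

theorem summable_pow_div_rpow {p : ℕ} {z : ℝ} (hz : 0 ≤ z) {σ : ℝ} (hσ : p + 1 < σ) :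
    Summable fun j : ℕ => ((j : ℝ) + 1) ^ p / (z + j + 1) ^ σ := by
  have h := (summable_nat_add_iff 1).2 (Real.summable_one_div_nat_rpow.2
    (show 1 < σ - p by linarith))
  refine h.of_nonneg_of_le (fun j => by positivity) (fun j => ?_)
  have hj : (0 : ℝ) < (j : ℝ) + 1 := by positivity
  push_cast
  rw [Real.rpow_sub hj, Real.rpow_natCast, one_div_div]
  gcongr
  · linarith [p.cast_nonneg (α := ℝ)]
  · linarith

theorem norm_natCast_add_one_pow (p j : ℕ) : ‖((j : ℂ) + 1) ^ p‖ = ((j : ℝ) + 1) ^ p := by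
  rw [norm_pow]
  norm_cast

theorem summable_shiftedSeries {p : ℕ} {z : ℝ} (hz : 0 ≤ z) {s : ℂ} (hs : p + 1 < s.re) :
    Summable fun j : ℕ => ((j : ℂ) + 1) ^ p / ((z + j + 1 : ℝ) : ℂ) ^ s := by
  refine Summable.of_norm ((summable_pow_div_rpow hz hs).congr fun j => ?_)
  rw [norm_div, norm_natCast_add_one_pow, norm_cpow_eq_rpow_re_of_pos (by positivity)]

/-- The Mellin transform takes `∑ j ^ p exp (-j t)`, with the factor `exp (-z t)`, to the Dirichlet
series. -/
theorem Gamma_mul_shiftedSeries {p : ℕ} {z : ℝ} (hz : 0 ≤ z) {s : ℂ} (hs : p + 1 < s.re)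
    {K : ℝ → ℂ} (hK : ∀ t : ℝ, 0 < t → HasSum (fun j : ℕ =>
      ((j : ℂ) + 1) ^ p * exp (-(t * (j + 1)))) (K t)) :
    Gamma s * shiftedSeries p z s =
      ∫ t : ℝ in Ioi 0, (t : ℂ) ^ (s - 1) * (exp (-(z * t)) * K t) := by
  have h := hasSum_mellin (a := fun j : ℕ => ((j : ℂ) + 1) ^ p)
    (p := fun j : ℕ => z + j + 1) (F := fun t => exp (-(z * t)) * K t) (s := s)
    (fun j => Or.inr (by positivity)) (by linarith [p.cast_nonneg (α := ℝ)]) ?_ ?_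
  · rw [shiftedSeries, ← tsum_mul_left]
    simp_rw [← mul_div_assoc]
    rw [h.tsum_eq, mellin]
    simp only [smul_eq_mul]
  · intro t ht
    refine ((hK t ht).mul_left (exp (-(z * t)))).congr_fun fun j => ?_
    rw [mul_left_comm, ← exp_add]
    push_cast
    ring_nf
  · simp only [norm_natCast_add_one_pow]
    exact summable_pow_div_rpow hz hs

theorem Gamma_eq_prod_mul_Gamma (n : ℕ) {s : ℂ} (hs : n < s.re) :
    Gamma s = (∏ i ∈ Finset.range n, (s - (i + 1))) * Gamma (s - n) := by
  induction n with
  | zero => simp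
  | succ n ih =>
    push_cast at hs
    rw [ih (by linarith), Finset.prod_range_succ, mul_assoc]
    congr 1
    have hne : s - (n + 1) ≠ 0 := by
      intro h
      have := congrArg re h
      simp at this
      linarith
    rw [show s - n = s - (n + 1) + 1 by ring, Gamma_add_one _ hne]
    push_cast
    ring_nf

theorem integral_cpow_mul_exp_mul_inv_pow {z : ℝ} (hz : 0 < z) (n : ℕ) {s : ℂ} (hs : n < s.re) :
    IntegrableOn (fun t : ℝ => (t : ℂ) ^ (s - 1) * (exp (-(z * t)) * (1 / (t : ℂ) ^ n))) (Ioi 0) ∧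
    ∫ t : ℝ in Ioi 0, (t : ℂ) ^ (s - 1) * (exp (-(z * t)) * (1 / (t : ℂ) ^ n)) =
      (z : ℂ) ^ (n - s) * Gamma (s - n) := by
  have hsn : 0 < (s - n).re := by simpa using hs
  have hcongr : EqOn (fun t : ℝ => (t : ℂ) ^ ((s - n) - 1) * exp (-(z * t)))
      (fun t : ℝ => (t : ℂ) ^ (s - 1) * (exp (-(z * t)) * (1 / (t : ℂ) ^ n))) (Ioi 0) := by
    intro t ht
    have ht0 : (t : ℂ) ≠ 0 := by exact_mod_cast (ne_of_gt ht)
    simp only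
    rw [show s - n - 1 = (s - 1) - n by ring, cpow_sub _ _ ht0, cpow_natCast]
    ring
  constructor
  · refine IntegrableOn.congr_fun ?_ hcongr measurableSet_Ioi
    refine Integrable.mono' (integrableOn_cpow_mul_exp_neg_mul hsn hz) (by fun_prop)
      (Eventually.of_forall fun t => ?_)
    rw [norm_mul, norm_exp_neg_mul_ofReal, ofReal_re]
  · rw [← setIntegral_congr_fun measurableSet_Ioi hcongr,
      integral_cpow_mul_exp_neg_mul_Ioi_of_re_pos hsn (by simpa using hz), neg_sub]

theorem norm_exp_neg_mul_le_one {t : ℝ} {w : ℂ} (hw : w.re = 0) : ‖exp (-(t * w))‖ ≤ 1 := by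
  rw [norm_exp]; simp [hw]

theorem integrable_prod_planaIntegrand {p : ℕ} (hp : 1 ≤ p) {z : ℝ} (hz : 0 < z) {s : ℂ}
    (hs : 0 < s.re) :
    Integrable (fun q : ℝ × ℝ => (q.1 : ℂ) ^ (s - 1) * (exp (-(z * q.1)) *
      planaIntegrand p (fun w => exp (-(q.1 * w))) q.2))
      ((volume.restrict (Ioi 0)).prod (volume.restrict (Ioi 0))) := by
  have h := (integrableOn_cpow_mul_exp_neg_mul hs hz).mul_prod
    ((integrableOn_one_add_pow_mul_exp p).const_mul 2)
  refine h.mono' ?_ ?_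
  · simp only [planaIntegrand]
    refine Measurable.aestronglyMeasurable ?_
    fun_prop
  · rw [Measure.prod_restrict]
    refine (ae_restrict_iff' (measurableSet_Ioi.prod measurableSet_Ioi)).2
      (Eventually.of_forall fun q hq => ?_)
    rw [norm_mul, norm_mul, norm_exp_neg_mul_ofReal, ofReal_re, ← mul_assoc]
    gcongr
    refine (norm_planaIntegrand_le hp hq.2 (c := 1) (norm_exp_neg_mul_le_one (by simp))
      (norm_exp_neg_mul_le_one (by simp))).trans_eq (by ring)

/-- The Mellin transform of the Abel-Plana correction term, by Fubini's theorem and Euler's integral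
for `(z ± i x) ^ (-s)`. -/
theorem integral_mul_planaIntegral {p : ℕ} (hp : 1 ≤ p) {z : ℝ} (hz : 0 < z) {s : ℂ}
    (hs : 0 < s.re) :
    IntegrableOn (fun t : ℝ => (t : ℂ) ^ (s - 1) * (exp (-(z * t)) *
      planaIntegral p (fun w => exp (-(t * w))))) (Ioi 0) ∧
    ∫ t : ℝ in Ioi 0, (t : ℂ) ^ (s - 1) * (exp (-(z * t)) *
      planaIntegral p (fun w => exp (-(t * w)))) =
      Gamma s * planaIntegral p (fun w => (z + w) ^ (-s)) := by
  have hint := integrable_prod_planaIntegrand hp hz hs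
  have hpull : ∀ t : ℝ, (t : ℂ) ^ (s - 1) * (exp (-(z * t)) *
      planaIntegral p (fun w => exp (-(t * w)))) = I * ∫ x : ℝ in Ioi 0,
        (t : ℂ) ^ (s - 1) * (exp (-(z * t)) * planaIntegrand p (fun w => exp (-(t * w))) x) := by
    intro t
    rw [planaIntegral, integral_const_mul, integral_const_mul]
    ring
  simp only [hpull]
  constructor
  · exact hint.integral_prod_left.const_mul I
  · rw [integral_const_mul, integral_integral_swap hint, planaIntegral, mul_left_comm,
      ← integral_const_mul (Gamma s)]
    congr 1
    refine setIntegral_congr_fun measurableSet_Ioi fun x hx => ?_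
    have hone : ∀ w : ℂ, w.re = 0 →
        IntegrableOn (fun t : ℝ => (t : ℂ) ^ (s - 1) * exp (-((z + w) * t))) (Ioi 0) := by
      intro w hw
      refine Integrable.mono' (integrableOn_cpow_mul_exp_neg_mul hs hz)
        (Measurable.aestronglyMeasurable (by fun_prop)) (Eventually.of_forall fun t => ?_)
      rw [norm_mul, norm_exp_neg_mul_ofReal, add_re, hw, ofReal_re, add_zero]
    have hval : ∀ w : ℂ, w.re = 0 →
        ∫ t : ℝ in Ioi 0, (t : ℂ) ^ (s - 1) * exp (-((z + w) * t)) = (z + w) ^ (-s) * Gamma s :=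
      fun w hw => integral_cpow_mul_exp_neg_mul_Ioi_of_re_pos hs (by simpa [hw] using hz)
    have h1 : (I * x : ℂ).re = 0 := by simp
    have h2 : (-(I * x) : ℂ).re = 0 := by simp
    have hsplit : ∀ t : ℝ, (t : ℂ) ^ (s - 1) * (exp (-(z * t)) *
        planaIntegrand p (fun w => exp (-(t * w))) x) =
        (I * x) ^ p / (exp (2 * Real.pi * x) - 1) *
          ((t : ℂ) ^ (s - 1) * exp (-((z + I * x) * t))) -
        (-(I * x)) ^ p / (exp (2 * Real.pi * x) - 1) *
          ((t : ℂ) ^ (s - 1) * exp (-((z + -(I * x)) * t))) := by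
      intro t
      rw [planaIntegrand, show (-((z + I * x) * t) : ℂ) = -(z * t) + -(t * (I * x)) by ring,
        show (-((z + -(I * x)) * t) : ℂ) = -(z * t) + -(t * -(I * x)) by ring, exp_add, exp_add]
      ring
    simp only [hsplit]
    rw [integral_sub ((hone _ h1).const_mul _) ((hone _ h2).const_mul _), integral_const_mul,
      integral_const_mul, hval _ h1, hval _ h2, planaIntegrand]
    ring

/-- The Abel-Plana formula for `∑ j ^ p (z + j) ^ (-s)`, `1 ≤ p`, obtained by applying the Mellin
transform to the one for `∑ j ^ p exp (-j t)`. -/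
theorem shiftedSeries_eq {p : ℕ} (hp : 1 ≤ p) {z : ℝ} (hz : 0 < z) {s : ℂ} (hs : p + 1 < s.re) :
    shiftedSeries p z s =
      p.factorial * (z : ℂ) ^ (p + 1 - s) / ∏ i ∈ Finset.range (p + 1), (s - (i + 1)) +
      planaIntegral p (fun w => (z + w) ^ (-s)) := by
  have hs0 : 0 < s.re := by linarith [p.cast_nonneg (α := ℝ)]
  have hs1 : ((p + 1 : ℕ) : ℝ) < s.re := by exact_mod_cast hs
  have h := Gamma_mul_shiftedSeries hz.le hs (fun t ht => hasSum_pow_mul_exp_neg hp ht)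
  obtain ⟨i1, e1⟩ := integral_cpow_mul_exp_mul_inv_pow hz (p + 1) hs1
  obtain ⟨i2, e2⟩ := integral_mul_planaIntegral hp hz hs0
  have hsplit : ∀ t : ℝ, (t : ℂ) ^ (s - 1) * (exp (-(z * t)) * (p.factorial / (t : ℂ) ^ (p + 1) +
      planaIntegral p (fun w => exp (-(t * w))))) =
      p.factorial * ((t : ℂ) ^ (s - 1) * (exp (-(z * t)) * (1 / (t : ℂ) ^ (p + 1)))) +
      (t : ℂ) ^ (s - 1) * (exp (-(z * t)) * planaIntegral p (fun w => exp (-(t * w)))) := by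
    intro t; ring
  simp only [hsplit] at h
  rw [integral_add (i1.const_mul _) i2, integral_const_mul, e1, e2] at h
  have hG := Gamma_eq_prod_mul_Gamma (p + 1) hs1
  have hG0 : Gamma s ≠ 0 := Gamma_ne_zero_of_re_pos hs0
  have hprod : ∏ i ∈ Finset.range (p + 1), (s - ((i : ℂ) + 1)) ≠ 0 := by
    intro h0; rw [h0, zero_mul] at hG; exact hG0 hG
  have hG1 : Gamma (s - (p + 1 : ℕ)) = Gamma s / ∏ i ∈ Finset.range (p + 1), (s - ((i : ℂ) + 1)) := by
    rw [eq_div_iff hprod, hG]; ring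
  rw [hG1] at h
  apply mul_left_cancel₀ hG0
  rw [h]
  push_cast
  ring

/-! ### Continuation of the Dirichlet series to `s = 0` -/

theorem hasDerivAt_planaIntegral {p : ℕ} (hp : 1 ≤ p) {φ φ' : ℂ → ℂ → ℂ} {s₀ : ℂ} {r c : ℝ} {M : ℕ}
    (hr : 0 < r) (hcont : ∀ s ∈ Metric.ball s₀ r, ∀ x : ℝ, ContinuousAt (φ s) (I * x))
    (hd : ∀ s ∈ Metric.ball s₀ r, ∀ x : ℝ, HasDerivAt (fun s => φ s (I * x)) (φ' s (I * x)) s)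
    (hb : ∀ s ∈ Metric.ball s₀ r, ∀ x : ℝ, ‖φ s (I * x)‖ ≤ c * (1 + |x|) ^ M) :
    HasDerivAt (fun s => planaIntegral p (φ s)) (planaIntegral p (φ' s₀)) s₀ := by
  have hd' : ∀ s ∈ Metric.ball s₀ r, ∀ x : ℝ,
      HasDerivAt (fun s => φ s (-(I * x))) (φ' s (-(I * x))) s := by
    intro s hs x; simpa using hd s hs (-x)
  have hder : ∀ s ∈ Metric.ball s₀ r, ∀ x : ℝ,
      HasDerivAt (fun s => planaIntegrand p (φ s) x) (planaIntegrand p (φ' s) x) s := by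
    intro s hs x
    exact (((hd s hs x).const_mul _).sub ((hd' s hs x).const_mul _)).div_const _
  have h := hasDerivAt_integral_of_holomorphic (μ := volume.restrict (Ioi 0)) hr
    (f := fun s x => planaIntegrand p (φ s) x)
    (g := fun x => 2 * c * ((1 + x) ^ (M + p) * Real.exp (-(Real.pi * x))))
    (fun s hs => aestronglyMeasurable_planaIntegrand p (hcont s hs))
    (Eventually.of_forall fun x s hs => (hder s hs x).differentiableAt.differentiableWithinAt)
    ?_ ((integrableOn_one_add_pow_mul_exp (M + p)).const_mul (2 * c))
  · have hderiv : ∀ x : ℝ, deriv (fun s => planaIntegrand p (φ s) x) s₀ =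
        planaIntegrand p (φ' s₀) x := fun x => (hder s₀ (Metric.mem_ball_self hr) x).deriv
    simp only [hderiv] at h
    exact h.2.const_mul I
  · refine (ae_restrict_iff' measurableSet_Ioi).2 (Eventually.of_forall fun x hx s hs => ?_)
    have hx' : (0 : ℝ) < x := hx
    refine (norm_planaIntegrand_le hp hx' (c := c * (1 + x) ^ M) ?_ ?_).trans_eq (by ring)
    · simpa [abs_of_pos hx'] using hb s hs x
    · simpa [abs_of_pos hx'] using hb s hs (-x)

theorem norm_cpow_neg_le {w s : ℂ} {A : ℝ} {S : ℕ} (h1 : ‖w‖ ≤ A) (h2 : ‖w‖⁻¹ ≤ A) (hw : w ≠ 0)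
    (hA : 1 ≤ A) (hs : ‖s‖ ≤ S) : ‖w ^ (-s)‖ ≤ Real.exp (Real.pi * S) * A ^ S := by
  have hw0 : 0 < ‖w‖ := norm_pos_iff.2 hw
  refine (norm_cpow_le w (-s)).trans ?_
  rw [div_eq_inv_mul, ← Real.exp_neg]
  have hre : |s.re| ≤ S := (abs_re_le_norm s).trans hs
  have him : |s.im| ≤ S := (abs_im_le_norm s).trans hs
  rw [abs_le] at hre
  gcongr
  · calc -(w.arg * (-s).im) ≤ |w.arg| * |s.im| := by
          rw [← abs_mul]; simpa using le_abs_self (w.arg * s.im)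
      _ ≤ Real.pi * S := by gcongr; exact abs_arg_le_pi w
  · rw [← Real.rpow_natCast A S, neg_re]
    rcases le_total 0 s.re with h | h
    · rw [Real.rpow_neg hw0.le, ← Real.inv_rpow hw0.le]
      exact (Real.rpow_le_rpow (by positivity) h2 h).trans
        (Real.rpow_le_rpow_of_exponent_le hA hre.2)
    · exact (Real.rpow_le_rpow (by positivity) h1 (by linarith)).trans
        (Real.rpow_le_rpow_of_exponent_le hA (by linarith [hre.1]))

theorem norm_log_le {w : ℂ} (hw : 0 < w.re) : ‖log w‖ ≤ ‖w‖ + w.re⁻¹ + Real.pi := by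
  have hw0 : 0 < ‖w‖ := hw.trans_le (re_le_norm w)
  have h1 : |Real.log ‖w‖| ≤ ‖w‖ + ‖w‖⁻¹ := by
    rw [abs_le]
    have h2 := Real.log_le_sub_one_of_pos hw0
    have h3 := Real.log_le_sub_one_of_pos (inv_pos.2 hw0)
    rw [Real.log_inv] at h3
    constructor
    · linarith
    · linarith [inv_pos.2 hw0]
  have h4 : ‖w‖⁻¹ ≤ w.re⁻¹ := inv_anti₀ hw (re_le_norm w)
  calc ‖log w‖ ≤ |(log w).re| + |(log w).im| := norm_le_abs_re_add_abs_im _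
    _ ≤ _ := by rw [log_re, log_im]; linarith [abs_arg_le_pi w]

theorem add_I_mul_mem_slitPlane {z : ℂ} (hz : 0 < z.re) (x : ℝ) : z + I * x ∈ slitPlane := by
  left; simpa using hz

theorem hasDerivAt_planaIntegral_cpow {p : ℕ} (hp : 1 ≤ p) {z : ℝ} (hz : 0 < z) (s : ℂ) :
    HasDerivAt (fun s => planaIntegral p (fun w => (z + w) ^ (-s)))
      (planaIntegral p (fun w => -(log (z + w) * (z + w) ^ (-s)))) s := by
  have hz' : 0 < (z : ℂ).re := by simpa using hz
  have hslit := add_I_mul_mem_slitPlane hz'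
  obtain ⟨S, hS⟩ := exists_nat_ge (‖s‖ + 1)
  refine hasDerivAt_planaIntegral (φ := fun s w => (z + w) ^ (-s))
    (φ' := fun s w => -(log (z + w) * (z + w) ^ (-s))) hp zero_lt_one
    (c := Real.exp (Real.pi * S) * ((1 + z⁻¹) * (1 + z)) ^ S) (M := S) ?_ ?_ ?_
  · intro s _ x
    exact ContinuousAt.cpow (by fun_prop) (by fun_prop) (hslit x)
  · intro s _ x
    have h0 : HasDerivAt (fun s : ℂ => -s) (-1) s := hasDerivAt_neg s
    have h := h0.const_cpow (c := (z : ℂ) + I * x) (Or.inl (slitPlane_ne_zero (hslit x)))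
    convert h using 1
    ring
  · intro s' hs' x
    have hz1 : 0 < z⁻¹ := inv_pos.2 hz
    have hx := abs_nonneg x
    have hle : ‖(z : ℂ) + I * x‖ ≤ z + |x| := by
      refine (norm_add_le _ _).trans_eq ?_
      simp [abs_of_pos hz]
    have hge : z ≤ ‖(z : ℂ) + I * x‖ := by
      refine le_trans ?_ (re_le_norm _)
      simp
    refine (norm_cpow_neg_le (A := (1 + z⁻¹) * (1 + z) * (1 + |x|)) (S := S) ?_ ?_
      (slitPlane_ne_zero (hslit x)) ?_ ?_).trans_eq ?_
    · refine hle.trans ?_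
      nlinarith [mul_nonneg hz.le hx, mul_nonneg hz1.le hx, mul_nonneg hz1.le hz.le,
        mul_nonneg (mul_nonneg hz1.le hz.le) hx]
    · refine (inv_anti₀ hz hge).trans ?_
      nlinarith [mul_nonneg hz.le hx, mul_nonneg hz1.le hx, mul_nonneg hz1.le hz.le,
        mul_nonneg (mul_nonneg hz1.le hz.le) hx]
    · nlinarith [mul_nonneg hz.le hx, mul_nonneg hz1.le hx, mul_nonneg hz1.le hz.le,
        mul_nonneg (mul_nonneg hz1.le hz.le) hx]
    · have h1 : ‖s' - s‖ < 1 := by simpa [dist_eq] using hs'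
      linarith [norm_le_norm_sub_add s' s]
    · rw [mul_pow]; ring

/-- The kernel of Binet's first formula, without the factor `1 / t`. -/
noncomputable def binetKernel (t : ℝ) : ℝ := 1 / (Real.exp t - 1) - 1 / t + 1 / 2

theorem binetKernel_nonneg {t : ℝ} (ht : 0 < t) : 0 ≤ binetKernel t := by
  have h1 : 0 < Real.exp t - 1 := by linarith [Real.add_one_lt_exp ht.ne']
  have hmono : MonotoneOn (fun t : ℝ => (t - 2) * Real.exp t + t) (Ici 0) := by
    refine monotoneOn_of_deriv_nonneg (convex_Ici 0) (by fun_prop) (by fun_prop) ?_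
    intro x _
    have hd : HasDerivAt (fun t : ℝ => (t - 2) * Real.exp t + t)
        (1 * Real.exp x + (x - 2) * Real.exp x + 1) x :=
      (((hasDerivAt_id x).sub_const 2).mul (Real.hasDerivAt_exp x)).add (hasDerivAt_id x)
    rw [hd.deriv]
    have h2 := Real.add_one_le_exp (-x)
    have h3 : Real.exp (-x) * Real.exp x = 1 := by rw [← Real.exp_add]; simp
    nlinarith [Real.exp_pos x]
  have h2 := hmono (mem_Ici.2 le_rfl) (mem_Ici.2 ht.le) ht.le
  simp only [zero_sub, Real.exp_zero, mul_one, add_zero] at h2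
  have h3 : binetKernel t = ((t - 2) * Real.exp t + t + 2) / (2 * t * (Real.exp t - 1)) := by
    rw [binetKernel]
    field_simp
    ring
  rw [h3]
  apply div_nonneg <;> nlinarith

theorem binetKernel_le_half {t : ℝ} (ht : 0 < t) : binetKernel t ≤ 1 / 2 := by
  have h1 : 1 / (Real.exp t - 1) ≤ 1 / t :=
    one_div_le_one_div_of_le ht (by linarith [Real.add_one_le_exp t])
  rw [binetKernel]; linarith

theorem binetKernel_le {t : ℝ} (ht : 0 < t) : binetKernel t ≤ t := by
  have h1 : 1 / (Real.exp t - 1) ≤ 1 / (t + t ^ 2 / 2) :=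
    one_div_le_one_div_of_le (by positivity) (by linarith [Real.quadratic_le_exp_of_nonneg ht.le])
  have h2 : 1 / (t + t ^ 2 / 2) - 1 / t + 1 / 2 ≤ t := by
    have h3 : 1 / (t + t ^ 2 / 2) - 1 / t + 1 / 2 = t / (2 * (2 + t)) := by
      field_simp
      ring
    rw [h3]
    refine div_le_self ht.le (by linarith)
  rw [binetKernel]; linarith

theorem abs_binetKernel_div_le {t : ℝ} (ht : 0 < t) : |binetKernel t / t| ≤ 1 := by
  rw [abs_of_nonneg (div_nonneg (binetKernel_nonneg ht) ht.le), div_le_one ht]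
  exact binetKernel_le ht

theorem measurable_binetKernel : Measurable binetKernel := by
  unfold binetKernel
  fun_prop

theorem hasSum_exp_neg_mul {t : ℝ} (ht : 0 < t) :
    HasSum (fun j : ℕ => ((j : ℂ) + 1) ^ 0 * exp (-(t * (j + 1))))
      (1 / (t : ℂ) ^ 1 - 1 / 2 + binetKernel t) := by
  have hlt : Real.exp (-t) < 1 := by simpa using ht
  have h := (hasSum_geometric_of_lt_one (Real.exp_pos (-t)).le hlt).mul_left (Real.exp (-t))
  have h2 := Complex.hasSum_ofReal.2 h
  have hval : Real.exp (-t) * (1 - Real.exp (-t))⁻¹ = 1 / t - 1 / 2 + binetKernel t := by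
    have h1 : 0 < Real.exp t - 1 := by linarith [Real.add_one_lt_exp ht.ne']
    rw [binetKernel, Real.exp_neg]
    have h3 : 1 - (Real.exp t)⁻¹ ≠ 0 := by rw [← Real.exp_neg]; linarith
    field_simp
    ring
  rw [hval] at h2
  push_cast at h2
  rw [pow_one]
  refine h2.congr_fun fun j => ?_
  rw [← exp_nat_mul, ← exp_add, pow_zero, one_mul]
  ring_nf

theorem differentiableAt_mellin_binetKernel {z : ℝ} (hz : 0 < z) {s : ℂ} (hs : -1 < s.re) :
    MellinConvergent (fun t => exp (-(z * t)) * binetKernel t) s ∧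
    DifferentiableAt ℂ (mellin (fun t => exp (-(z * t)) * binetKernel t)) s := by
  have hcont : ContinuousOn (fun t : ℝ => exp (-(z * t)) * (binetKernel t : ℂ)) (Ioi 0) := by
    intro t ht
    have ht' : (0 : ℝ) < t := ht
    have h1 : Real.exp t - 1 ≠ 0 := by linarith [Real.add_one_lt_exp ht'.ne']
    refine ContinuousAt.continuousWithinAt (ContinuousAt.mul (by fun_prop) ?_)
    refine Complex.continuous_ofReal.continuousAt.comp ?_
    unfold binetKernel
    exact ((continuousAt_const.div (Real.continuous_exp.continuousAt.sub continuousAt_const) h1).sub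
      (continuousAt_const.div continuousAt_id ht'.ne')).add continuousAt_const
  have htop : (fun t : ℝ => exp (-(z * t)) * (binetKernel t : ℂ)) =O[atTop]
      fun t => Real.exp (-z * t) := by
    refine Asymptotics.IsBigO.of_bound 1 ?_
    filter_upwards [eventually_gt_atTop 0] with t ht
    rw [norm_mul, norm_exp_neg_mul_ofReal, norm_real, ofReal_re, Real.norm_of_nonneg
      (binetKernel_nonneg ht), Real.norm_of_nonneg (Real.exp_pos _).le, neg_mul, one_mul]
    exact mul_le_of_le_one_right (Real.exp_pos _).le ((binetKernel_le_half ht).trans (by norm_num))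
  have hbot : (fun t : ℝ => exp (-(z * t)) * (binetKernel t : ℂ)) =O[𝓝[>] 0]
      fun t => t ^ (-(-1 : ℝ)) := by
    refine Asymptotics.IsBigO.of_bound 1 ?_
    filter_upwards [self_mem_nhdsWithin] with t ht
    have ht' : (0 : ℝ) < t := ht
    rw [norm_mul, norm_exp_neg_mul_ofReal, norm_real, ofReal_re, Real.norm_of_nonneg
      (binetKernel_nonneg ht), neg_neg, Real.rpow_one, one_mul, Real.norm_of_nonneg ht'.le]
    refine (mul_le_of_le_one_left (binetKernel_nonneg ht) ?_).trans (binetKernel_le ht)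
    rw [Real.exp_le_one_iff]
    nlinarith
  have hloc := hcont.locallyIntegrableOn (μ := volume) measurableSet_Ioi
  exact ⟨mellinConvergent_of_isBigO_rpow_exp hz hloc htop hbot hs,
    mellin_differentiableAt_of_isBigO_rpow_exp hz hloc htop hbot hs⟩

/-- The analogue of `shiftedSeries_eq` for `p = 0`. The factor `s / Γ(s + 1)` is `1 / Γ(s)`,
written so that the derivative at the zero `s = 0` is visible. -/
theorem shiftedSeries_zero_eq {z : ℝ} (hz : 0 < z) {s : ℂ} (hs : 1 < s.re) :
    shiftedSeries 0 z s = (z : ℂ) ^ (1 - s) / (s - 1) - (z : ℂ) ^ (-s) / 2 +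
      s * (Gamma (s + 1))⁻¹ * mellin (fun t => exp (-(z * t)) * binetKernel t) s := by
  have h := Gamma_mul_shiftedSeries (p := 0) hz.le (by simpa using hs) (fun t ht => hasSum_exp_neg_mul ht)
  obtain ⟨i1, e1⟩ := integral_cpow_mul_exp_mul_inv_pow hz 1 (s := s) (by simpa using hs)
  obtain ⟨i2, e2⟩ := integral_cpow_mul_exp_mul_inv_pow hz 0 (s := s) (by simp; linarith)
  have i3 := (differentiableAt_mellin_binetKernel hz (s := s) (by linarith)).1
  simp only [MellinConvergent, smul_eq_mul] at i3
  have hsplit : ∀ t : ℝ, (t : ℂ) ^ (s - 1) * (exp (-(z * t)) * (1 / (t : ℂ) ^ 1 - 1 / 2 +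
      binetKernel t)) =
      (t : ℂ) ^ (s - 1) * (exp (-(z * t)) * (1 / (t : ℂ) ^ 1)) -
      1 / 2 * ((t : ℂ) ^ (s - 1) * (exp (-(z * t)) * (1 / (t : ℂ) ^ 0))) +
      (t : ℂ) ^ (s - 1) * (exp (-(z * t)) * binetKernel t) := by
    intro t; simp; ring
  simp only [hsplit] at h
  have e3 := integral_add (i1.sub (i2.const_mul (1 / 2))) i3
  simp only [Pi.sub_apply] at e3
  rw [e3, integral_sub i1 (i2.const_mul _), integral_const_mul, e1, e2] at h
  have hG0 : Gamma s ≠ 0 := Gamma_ne_zero_of_re_pos (by linarith)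
  have hne : s - 1 ≠ 0 := by
    intro h0
    rw [sub_eq_zero] at h0
    simp [h0] at hs
  have hG1 : Gamma s = (s - 1) * Gamma (s - 1) := by
    have := Gamma_add_one (s - 1) hne
    simpa using this
  have hs0 : s ≠ 0 := by rintro rfl; simp at hs; linarith
  have hG2 : s * (Gamma (s + 1))⁻¹ = (Gamma s)⁻¹ := by
    rw [Gamma_add_one _ hs0]; field_simp
  rw [hG2]
  apply mul_left_cancel₀ hG0
  rw [h, mellin]
  simp only [smul_eq_mul, Nat.cast_one, Nat.cast_zero, sub_zero, zero_sub]
  have hG3 : Gamma (s - 1) = Gamma s / (s - 1) := by rw [hG1]; field_simp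
  rw [hG3, mul_add, ← mul_assoc (Gamma s), mul_inv_cancel₀ hG0]
  ring

/-! ### Zeta-regularized logarithmic sums -/

/-- The part of the regularized sum `∑_{j ≥ 1} j ^ p log (z + j)` that is not elementary: for
`1 ≤ p` the Abel-Plana correction term, for `p = 0` the remainder in Binet's first formula. -/
noncomputable def logSumRemainder (p : ℕ) (z : ℂ) : ℂ :=
  if p = 0 then -(log z) / 2 - ∫ t : ℝ in Ioi 0, exp (-(z * t)) * ((binetKernel t / t : ℝ) : ℂ)
  else planaIntegral p (fun w => log (z + w))

/-- The zeta-regularized sum `∑_{j ≥ 1} j ^ p log (z + j)`, that is, minus the derivative at `s = 0`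
of the continuation of `∑_{j ≥ 1} j ^ p (z + j) ^ (-s)`. -/
noncomputable def logSum (p : ℕ) (z : ℂ) : ℂ :=
  (-1) ^ (p + 1) * (z ^ (p + 1) * (log z - ((harmonic (p + 1) : ℚ) : ℂ))) / (p + 1) +
    logSumRemainder p z

theorem hasDerivAt_prod_sub (n : ℕ) :
    (∏ i ∈ Finset.range n, ((0 : ℂ) - ((i : ℂ) + 1))) = (-1) ^ n * n.factorial ∧
    HasDerivAt (fun s : ℂ => ∏ i ∈ Finset.range n, (s - ((i : ℂ) + 1)))
      (-((-1) ^ n * n.factorial * ((harmonic n : ℚ) : ℂ))) 0 := by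
  induction n with
  | zero => simpa using hasDerivAt_const (0 : ℂ) (1 : ℂ)
  | succ n ih =>
    have hn : (n : ℂ) + 1 ≠ 0 := by exact_mod_cast n.succ_ne_zero
    simp only [Finset.prod_range_succ]
    constructor
    · rw [ih.1, Nat.factorial_succ]; push_cast; ring
    · have h := ih.2.mul ((hasDerivAt_id (0 : ℂ)).sub_const ((n : ℂ) + 1))
      rw [ih.1] at h
      refine h.congr_deriv ?_
      rw [Nat.factorial_succ, harmonic_succ]
      push_cast
      simp only [id]
      field_simp
      ring

theorem hasDerivAt_cpow_div_prod (p : ℕ) {z : ℂ} (hz : z ≠ 0) :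
    HasDerivAt (fun s : ℂ => p.factorial * z ^ (p + 1 - s) /
        ∏ i ∈ Finset.range (p + 1), (s - ((i : ℂ) + 1)))
      (-((-1) ^ (p + 1) * (z ^ (p + 1) * (log z - ((harmonic (p + 1) : ℚ) : ℂ))) / (p + 1))) 0 := by
  obtain ⟨h0, h1⟩ := hasDerivAt_prod_sub (p + 1)
  have hfac : (p.factorial : ℂ) ≠ 0 := by exact_mod_cast p.factorial_ne_zero
  have hp : (p : ℂ) + 1 ≠ 0 := by exact_mod_cast p.succ_ne_zero
  have hone : ((-1 : ℂ) ^ (p + 1)) ≠ 0 := pow_ne_zero _ (by norm_num)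
  have hsq : ((-1 : ℂ) ^ (p + 1)) * (-1) ^ (p + 1) = 1 := by rw [← mul_pow]; simp
  have hn : ((p + 1).factorial : ℂ) = (p + 1) * p.factorial := by
    rw [Nat.factorial_succ]; push_cast; ring
  have h2 : HasDerivAt (fun s : ℂ => z ^ ((p : ℂ) + 1 - s)) (z ^ (p + 1) * log z * (-1)) 0 := by
    have h3 : HasDerivAt (fun s : ℂ => (p : ℂ) + 1 - s) (-1) 0 := by
      simpa using (hasDerivAt_id (0 : ℂ)).const_sub ((p : ℂ) + 1)
    have h4 := h3.const_cpow (c := z) (Or.inl hz)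
    have h5 : z ^ ((p : ℂ) + 1 - 0) = z ^ (p + 1) := by
      rw [sub_zero]; exact_mod_cast cpow_natCast z (p + 1)
    rwa [h5] at h4
  have h5 : z ^ ((p : ℂ) + 1 - 0) = z ^ (p + 1) := by
    rw [sub_zero]; exact_mod_cast cpow_natCast z (p + 1)
  have hne : (∏ i ∈ Finset.range (p + 1), ((0 : ℂ) - ((i : ℂ) + 1))) ≠ 0 := by
    rw [h0, hn]; exact mul_ne_zero hone (mul_ne_zero hp hfac)
  refine ((h2.const_mul (p.factorial : ℂ)).div h1 hne).congr_deriv ?_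
  rw [h0, h5, hn]
  generalize (-1 : ℂ) ^ (p + 1) = e at *
  field_simp
  linear_combination (log z - ((harmonic (p + 1) : ℚ) : ℂ)) * hsq

theorem differentiableOn_cpow_div_prod (p : ℕ) {z : ℂ} (hz : z ≠ 0) :
    DifferentiableOn ℂ (fun s : ℂ => p.factorial * z ^ (p + 1 - s) /
        ∏ i ∈ Finset.range (p + 1), (s - ((i : ℂ) + 1))) continuationDomain := by
  intro s hs
  refine DifferentiableAt.differentiableWithinAt (DifferentiableAt.div ?_ (by fun_prop) ?_)
  · exact ((differentiableAt_const _).sub differentiableAt_id).const_cpow (Or.inl hz)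
      |>.const_mul _
  · exact Finset.prod_ne_zero_iff.2 fun i _ => sub_natCast_succ_ne_zero hs i

/-- The continuation of the Dirichlet series to a neighbourhood of `s = 0`, and its
derivative there. -/
theorem exists_continuation_shiftedSeries (p : ℕ) {z : ℝ} (hz : 0 < z) :
    ∃ f : ℂ → ℂ, DifferentiableOn ℂ f continuationDomain ∧
      (∀ s ∈ continuationDomain, p + 1 < s.re → f s = shiftedSeries p z s) ∧
      HasDerivAt f (-logSum p z) 0 := by
  have hz0 : (z : ℂ) ≠ 0 := by exact_mod_cast hz.ne'
  rcases Nat.eq_zero_or_pos p with rfl | hp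
  · refine ⟨fun s => ((0 : ℕ).factorial * (z : ℂ) ^ ((0 : ℕ) + 1 - s) /
      ∏ i ∈ Finset.range (0 + 1), (s - ((i : ℂ) + 1))) - (z : ℂ) ^ (-s) / 2 +
      s * ((Gamma (s + 1))⁻¹ * mellin (fun t => exp (-(z * t)) * binetKernel t) s), ?_, ?_, ?_⟩
    · refine ((differentiableOn_cpow_div_prod 0 hz0).sub ?_).add ?_
      · exact ((differentiable_id.neg.const_cpow (Or.inl hz0)).div_const _).differentiableOn
      · refine differentiableOn_id.mul (DifferentiableOn.mul ?_ fun s hs =>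
          (differentiableAt_mellin_binetKernel hz hs.1).2.differentiableWithinAt)
        exact (differentiable_one_div_Gamma.comp (differentiable_id.add_const 1)).differentiableOn
    · intro s _ hs
      rw [shiftedSeries_zero_eq hz (by simpa using hs)]
      simp [mul_assoc]
    · have h1 := hasDerivAt_cpow_div_prod 0 hz0
      have h2 : HasDerivAt (fun s : ℂ => (z : ℂ) ^ (-s) / 2) (-(log z) / 2) 0 := by
        have h := ((hasDerivAt_neg (0 : ℂ)).const_cpow (c := (z : ℂ)) (Or.inl hz0)).div_const 2
        simpa using h
      have h3 : DifferentiableAt ℂ (fun s : ℂ => (Gamma (s + 1))⁻¹ *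
          mellin (fun t => exp (-(z * t)) * binetKernel t) s) 0 :=
        (differentiable_one_div_Gamma.comp (differentiable_id.add_const 1)).differentiableAt.mul
          (differentiableAt_mellin_binetKernel hz (by simp)).2
      have h4 := (hasDerivAt_id (0 : ℂ)).mul h3.hasDerivAt
      refine ((h1.sub h2).add h4).congr_deriv ?_
      have h5 : mellin (fun t => exp (-(z * t)) * (binetKernel t : ℂ)) 0 =
          ∫ t : ℝ in Ioi 0, exp (-(z * t)) * ((binetKernel t / t : ℝ) : ℂ) := by
        refine setIntegral_congr_fun measurableSet_Ioi fun t _ => ?_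
        simp only [zero_sub, cpow_neg_one, smul_eq_mul]
        push_cast
        ring
      rw [logSum, logSumRemainder, if_pos rfl, ← h5]
      simp
      ring
  · refine ⟨fun s => p.factorial * (z : ℂ) ^ (p + 1 - s) /
      ∏ i ∈ Finset.range (p + 1), (s - (i + 1)) + planaIntegral p (fun w => (z + w) ^ (-s)),
      ?_, ?_, ?_⟩
    · exact (differentiableOn_cpow_div_prod p hz0).add fun s _ =>
        (hasDerivAt_planaIntegral_cpow hp hz s).differentiableAt.differentiableWithinAt
    · intro s _ hs
      exact (shiftedSeries_eq hp hz hs).symm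
    · refine ((hasDerivAt_cpow_div_prod p hz0).add
        (hasDerivAt_planaIntegral_cpow hp hz 0)).congr_deriv ?_
      rw [logSum, logSumRemainder, if_neg (by lia), neg_add]
      congr 1
      simp only [planaIntegral, planaIntegrand, neg_zero, cpow_zero, mul_one]
      rw [← mul_neg, ← integral_neg]
      congr 1
      refine integral_congr_ae (Eventually.of_forall fun x => ?_)
      ring

theorem shiftedSeries_rec (p : ℕ) {z : ℝ} (hz : 0 ≤ z) {s : ℂ} (hs : p + 1 < s.re) :
    shiftedSeries p z s = ((z + 1 : ℝ) : ℂ) ^ (-s) +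
      ∑ k ∈ Finset.range (p + 1), (p.choose k : ℂ) * shiftedSeries k (z + 1) s := by
  have hsum := summable_shiftedSeries hz hs
  rw [shiftedSeries, hsum.tsum_eq_zero_add]
  congr 1
  · simp [cpow_neg]
  · have hk : ∀ k ∈ Finset.range (p + 1), Summable fun j : ℕ => (p.choose k : ℂ) *
        (((j : ℂ) + 1) ^ k / ((z + 1 + j + 1 : ℝ) : ℂ) ^ s) := by
      intro k hk
      have hkp : (k : ℝ) ≤ p := by exact_mod_cast Finset.mem_range_succ_iff.1 hk
      exact (summable_shiftedSeries (by linarith) (by linarith)).mul_left _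
    simp only [shiftedSeries, ← tsum_mul_left]
    rw [← Summable.tsum_finsetSum hk]
    refine tsum_congr fun j => ?_
    push_cast
    rw [show (z : ℂ) + (j + 1) + 1 = z + 1 + j + 1 by ring, add_pow, Finset.sum_div]
    refine Finset.sum_congr rfl fun k _ => ?_
    rw [one_pow]
    ring

theorem shiftedSeries_one_eq_zeta (p : ℕ) {s : ℂ} (hs : p + 1 < s.re) :
    shiftedSeries p 1 s = ∑ k ∈ Finset.range (p + 1), (p.choose k : ℂ) * (-1) ^ (p - k) *
      riemannZeta (s - k) - 0 ^ p := by
  have hz : ∀ k ∈ Finset.range (p + 1),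
      HasSum (fun j : ℕ => 1 / ((j : ℂ) + 2) ^ (s - k)) (riemannZeta (s - k) - 1) := by
    intro k hk
    have hkp : (k : ℝ) ≤ p := by exact_mod_cast Finset.mem_range_succ_iff.1 hk
    have hre : 1 < (s - k).re := by simp; linarith
    have h1 : Summable fun n : ℕ => 1 / ((n : ℂ) + 1) ^ (s - k) := by
      have := (summable_nat_add_iff 1).2 (Complex.summable_one_div_nat_cpow.2 hre)
      simpa using this
    have h2 := (hasSum_nat_add_iff' 1).2 h1.hasSum
    rw [← zeta_eq_tsum_one_div_nat_add_one_cpow hre] at h2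
    simp only [Finset.range_one, Finset.sum_singleton, Nat.cast_zero, zero_add, one_cpow,
      div_one] at h2
    refine h2.congr_fun fun j => ?_
    push_cast
    ring_nf
  have h := hasSum_sum fun k hk => (hz k hk).mul_left ((p.choose k : ℂ) * (-1) ^ (p - k))
  have hbin : ∑ k ∈ Finset.range (p + 1), (p.choose k : ℂ) * (-1) ^ (p - k) = 0 ^ p := by
    have := add_pow (1 : ℂ) (-1) p
    simp only [one_pow, one_mul, add_neg_cancel] at this
    rw [this]
    exact Finset.sum_congr rfl fun k _ => mul_comm _ _
  simp only [mul_sub, mul_one, Finset.sum_sub_distrib, hbin] at h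
  rw [← h.tsum_eq, shiftedSeries]
  refine tsum_congr fun j => ?_
  have hj : (j : ℂ) + 2 ≠ 0 := by exact_mod_cast (show (j + 2 : ℕ) ≠ 0 by lia)
  have e : ((1 + j + 1 : ℝ) : ℂ) = j + 2 := by push_cast; ring
  rw [e, show (j : ℂ) + 1 = (j + 2) + (-1) by ring, add_pow, Finset.sum_div]
  refine Finset.sum_congr rfl fun k _ => ?_
  rw [cpow_sub _ _ hj, cpow_natCast]
  field_simp

/-- The shift `z ↦ z + 1` of the regularized sums `∑ j ^ p log (z + j)`. -/
theorem logSum_rec (p : ℕ) {z : ℝ} (hz : 0 < z) :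
    logSum p z = log ((z : ℂ) + 1) +
      ∑ k ∈ Finset.range (p + 1), (p.choose k : ℂ) * logSum k ((z : ℂ) + 1) := by
  obtain ⟨f, hf, hfs, hfd⟩ := exists_continuation_shiftedSeries p hz
  choose g hg hgs hgd using fun k => exists_continuation_shiftedSeries k
    (show 0 < z + 1 by linarith)
  have hne : ((z + 1 : ℝ) : ℂ) ≠ 0 := by exact_mod_cast (show z + 1 ≠ 0 by linarith)
  have heq := eqOn_continuationDomain (c := p + 1) hf
    (g := fun s => ((z + 1 : ℝ) : ℂ) ^ (-s) +
      ∑ k ∈ Finset.range (p + 1), (p.choose k : ℂ) * g k s) ?_ ?_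
  · have hd : HasDerivAt (fun s => ((z + 1 : ℝ) : ℂ) ^ (-s) +
        ∑ k ∈ Finset.range (p + 1), (p.choose k : ℂ) * g k s)
        (-log ((z + 1 : ℝ) : ℂ) +
          ∑ k ∈ Finset.range (p + 1), (p.choose k : ℂ) * -logSum k ((z + 1 : ℝ) : ℂ)) 0 := by
      refine HasDerivAt.add ?_ (HasDerivAt.fun_sum fun k _ => (hgd k).const_mul _)
      simpa using (hasDerivAt_neg (0 : ℂ)).const_cpow (Or.inl hne)
    have := (hfd.congr_of_eventuallyEq (heq.symm.eventuallyEq_of_mem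
      (isOpen_continuationDomain.mem_nhds zero_mem_continuationDomain))).unique hd
    rw [← neg_inj, this]
    push_cast
    rw [neg_add, ← Finset.sum_neg_distrib]
    simp only [mul_neg]
  · refine DifferentiableOn.add ?_ (DifferentiableOn.fun_sum fun k _ => (hg k).const_mul _)
    exact (differentiable_id.neg.const_cpow (Or.inl hne)).differentiableOn
  · intro s hs hre
    rw [hfs s hs hre, shiftedSeries_rec p hz.le hre]
    congr 1
    refine Finset.sum_congr rfl fun k hk => ?_
    have hkp : (k : ℝ) ≤ p := by exact_mod_cast Finset.mem_range_succ_iff.1 hk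
    rw [hgs k s hs (by linarith)]

/-- The value at `z = 1`: the series `∑_{j ≥ 1} j ^ p (j + 1) ^ (-s)` is a combination of shifted
zeta functions, by expanding `j = (j + 1) - 1`. -/
theorem logSum_one (p : ℕ) :
    logSum p 1 = -∑ k ∈ Finset.range (p + 1), (p.choose k : ℂ) * (-1) ^ (p - k) *
      deriv riemannZeta (-(k : ℂ)) := by
  obtain ⟨f, hf, hfs, hfd⟩ := exists_continuation_shiftedSeries p zero_lt_one
  have hζ : ∀ (k : ℕ), ∀ s ∈ continuationDomain,
      HasDerivAt (fun s => riemannZeta (s - k)) (deriv riemannZeta (s - k)) s := by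
    intro k s hs
    have h1 : s - k ≠ 1 := by
      intro h
      apply sub_natCast_succ_ne_zero hs k
      rw [← h]; ring
    have h2 := (differentiableAt_riemannZeta h1).hasDerivAt.comp s ((hasDerivAt_id s).sub_const (k : ℂ))
    simpa using! h2
  have heq := eqOn_continuationDomain (c := p + 1) hf
    (g := fun s => ∑ k ∈ Finset.range (p + 1), (p.choose k : ℂ) * (-1) ^ (p - k) *
      riemannZeta (s - k) - 0 ^ p) ?_ ?_
  · have hd : HasDerivAt (fun s => ∑ k ∈ Finset.range (p + 1), (p.choose k : ℂ) * (-1) ^ (p - k) *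
        riemannZeta (s - k) - 0 ^ p) (∑ k ∈ Finset.range (p + 1), (p.choose k : ℂ) *
          (-1) ^ (p - k) * deriv riemannZeta (0 - k)) 0 :=
      (HasDerivAt.fun_sum fun k _ => (hζ k 0 zero_mem_continuationDomain).const_mul _).sub_const _
    have := (hfd.congr_of_eventuallyEq (heq.symm.eventuallyEq_of_mem
      (isOpen_continuationDomain.mem_nhds zero_mem_continuationDomain))).unique hd
    simp only [zero_sub, ofReal_one] at this
    rw [← this, neg_neg]
  · exact (DifferentiableOn.fun_sum fun k _ => DifferentiableOn.const_mul
      (fun s hs => (hζ k s hs).differentiableAt.differentiableWithinAt) _).sub_const _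
  · intro s hs hre
    rw [hfs s hs hre, shiftedSeries_one_eq_zeta p hre]

/-! ### Normalization, holomorphy and growth in `z` -/

/-- The linear functional on polynomials with the moments `a`. -/
noncomputable def umbral (a : ℕ → ℂ) : Polynomial ℂ →ₗ[ℂ] ℂ :=
  (Polynomial.basisMonomials ℂ).constr ℂ a

theorem umbral_X_pow (a : ℕ → ℂ) (k : ℕ) : umbral a (Polynomial.X ^ k) = a k := by
  simpa only [umbral, Polynomial.coe_basisMonomials, Polynomial.X_pow_eq_monomial] using
    (Polynomial.basisMonomials ℂ).constr_basis ℂ a k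

/-- The polynomial correction `-∑ (-1) ^ k (p choose k) ζ'(-k) z ^ (p - k)`. -/
noncomputable def zetaCorrection (p : ℕ) (z : ℂ) : ℂ :=
  -∑ k ∈ Finset.range (p + 1), (-1) ^ k * (p.choose k : ℂ) * deriv riemannZeta (-(k : ℂ)) *
    z ^ (p - k)

/-- The zeta-regularized sum `-∑_{j ≥ 1} (-j) ^ p log (z + j)`, with the polynomial in `z` added
that makes it vanish at `z = 1` and leaves its recurrence under `z ↦ z + 1` unchanged. -/
noncomputable def normalizedLogSum (p : ℕ) (z : ℂ) : ℂ :=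
  -((-1) ^ p * logSum p z) + zetaCorrection p z

theorem zetaCorrection_eq_umbral (p : ℕ) (z : ℂ) :
    zetaCorrection p z =
      -umbral (fun k => deriv riemannZeta (-(k : ℂ))) ((Polynomial.C z - Polynomial.X) ^ p) := by
  rw [zetaCorrection, sub_eq_neg_add, add_pow, map_sum]
  congr 1
  refine Finset.sum_congr rfl fun k _ => ?_
  rw [show (-Polynomial.X : Polynomial ℂ) ^ k * Polynomial.C z ^ (p - k) * (p.choose k : Polynomial ℂ) =
    ((-1) ^ k * (p.choose k : ℂ) * z ^ (p - k)) • Polynomial.X ^ k by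
      rw [Polynomial.smul_eq_C_mul, neg_pow]
      simp only [map_mul, map_pow, map_neg, map_one, map_natCast]
      ring]
  rw [map_smul, umbral_X_pow, smul_eq_mul]
  ring

/-- The homogeneous recurrence of the correction terms: umbrally they are the powers of `z - X`. -/
theorem zetaCorrection_shift (p : ℕ) (z : ℂ) :
    zetaCorrection p z = ∑ k ∈ Finset.range (p + 1),
      (p.choose k : ℂ) * (-1) ^ (p - k) * zetaCorrection k (z + 1) := by
  simp only [zetaCorrection_eq_umbral, mul_neg, Finset.sum_neg_distrib]
  rw [show (Polynomial.C z - Polynomial.X : Polynomial ℂ) =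
    (Polynomial.C (z + 1) - Polynomial.X) + (-1) by simp; ring, add_pow, map_sum]
  congr 1
  refine Finset.sum_congr rfl fun k _ => ?_
  rw [show (Polynomial.C (z + 1) - Polynomial.X : Polynomial ℂ) ^ k * (-1) ^ (p - k) *
      (p.choose k : Polynomial ℂ) =
    ((p.choose k : ℂ) * (-1) ^ (p - k)) • (Polynomial.C (z + 1) - Polynomial.X) ^ k by
      rw [Polynomial.smul_eq_C_mul]
      simp only [map_mul, map_pow, map_neg, map_one, map_natCast]
      ring]
  rw [map_smul, smul_eq_mul]

theorem neg_one_pow_sub_mul {p k : ℕ} (hk : k ∈ Finset.range (p + 1)) :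
    (-1 : ℂ) ^ (p - k) * (-1) ^ k = (-1) ^ p := by
  rw [← pow_add, Nat.sub_add_cancel (Finset.mem_range_succ_iff.1 hk)]

theorem normalizedLogSum_one (p : ℕ) : normalizedLogSum p 1 = 0 := by
  rw [normalizedLogSum, logSum_one, zetaCorrection, mul_neg, neg_neg, Finset.mul_sum, ← sub_eq_add_neg,
    ← Finset.sum_sub_distrib]
  refine Finset.sum_eq_zero fun k hk => ?_
  have h := neg_one_pow_sub_mul hk
  have h2 : (-1 : ℂ) ^ p * (-1) ^ (p - k) = (-1) ^ k := by
    have h3 : (-1 : ℂ) ^ (p - k) * (-1) ^ (p - k) = 1 := by rw [← mul_pow]; simp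
    rw [← h]
    linear_combination (-1 : ℂ) ^ k * h3
  rw [one_pow]
  linear_combination (p.choose k : ℂ) * deriv riemannZeta (-(k : ℂ)) * h2

theorem normalizedLogSum_shift_ofReal (p : ℕ) {x : ℝ} (hx : 0 < x) :
    normalizedLogSum p x = ∑ k ∈ Finset.range (p + 1), (p.choose k : ℂ) * (-1) ^ (p - k) *
      normalizedLogSum k (x + 1) - (-1) ^ p * log ((x : ℂ) + 1) := by
  simp only [normalizedLogSum, mul_add, Finset.sum_add_distrib]
  rw [logSum_rec p hx, zetaCorrection_shift p x, mul_add, Finset.mul_sum]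
  have h : ∑ k ∈ Finset.range (p + 1), (p.choose k : ℂ) * (-1) ^ (p - k) *
      -((-1) ^ k * logSum k ((x : ℂ) + 1)) = -∑ k ∈ Finset.range (p + 1),
        (-1) ^ p * ((p.choose k : ℂ) * logSum k ((x : ℂ) + 1)) := by
    rw [← Finset.sum_neg_distrib]
    refine Finset.sum_congr rfl fun k hk => ?_
    rw [← neg_one_pow_sub_mul hk]
    ring
  rw [h]
  ring

theorem norm_log_add_I_mul_le {z : ℂ} (hz : 0 < z.re) (x : ℝ) :
    ‖log (z + I * x)‖ ≤ (‖z‖ + z.re⁻¹ + 5) * (1 + |x|) ^ 1 := by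
  have hre : (z + I * x).re = z.re := by simp
  have h := norm_log_le (w := z + I * x) (by rwa [hre])
  have h2 : ‖z + I * x‖ ≤ ‖z‖ + |x| := (norm_add_le _ _).trans_eq (by simp)
  rw [hre] at h
  have h3 := Real.pi_lt_four
  have h4 := inv_pos.2 hz
  nlinarith [abs_nonneg x, norm_nonneg z, mul_nonneg (norm_nonneg z) (abs_nonneg x),
    mul_nonneg h4.le (abs_nonneg x)]

theorem re_ball {z w : ℂ} {r : ℝ} (h : w ∈ Metric.ball z r) : z.re - r < w.re := by
  have h1 : |(w - z).re| < r := (abs_re_le_norm _).trans_lt (by simpa [dist_eq] using h)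
  rw [sub_re, abs_lt] at h1
  linarith [h1.1]

theorem continuousAt_log_add {z : ℂ} (hz : 0 < z.re) (x : ℝ) :
    ContinuousAt (fun w => log (z + w)) (I * x) :=
  ContinuousAt.clog (by fun_prop) (add_I_mul_mem_slitPlane hz x)

theorem differentiableAt_planaIntegral_log {p : ℕ} (hp : 1 ≤ p) {z : ℂ} (hz : 0 < z.re) :
    DifferentiableAt ℂ (fun z => planaIntegral p (fun w => log (z + w))) z := by
  have hball : ∀ w ∈ Metric.ball z (z.re / 2), z.re / 2 < w.re := fun w hw => by
    linarith [re_ball hw]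
  refine (hasDerivAt_planaIntegral (φ := fun z w => log (z + w)) (φ' := fun z w => 1 / (z + w)) hp
    (half_pos hz) (c := ‖z‖ + z.re + 2 * z.re⁻¹ + 5) (M := 1) ?_ ?_ ?_).differentiableAt
  · exact fun s hs x => continuousAt_log_add ((half_pos hz).trans (hball s hs)) x
  · intro s hs x
    exact ((hasDerivAt_id s).add_const (I * (x : ℂ))).clog
      (add_I_mul_mem_slitPlane ((half_pos hz).trans (hball s hs)) x)
  · intro s hs x
    have h1 := hball s hs
    have h2 : ‖s - z‖ < z.re / 2 := by simpa [dist_eq] using hs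
    refine (norm_log_add_I_mul_le ((half_pos hz).trans h1) x).trans ?_
    have h3 : s.re⁻¹ ≤ 2 * z.re⁻¹ := by
      have := inv_anti₀ (half_pos hz) h1.le
      rwa [inv_div, div_eq_mul_inv] at this
    gcongr
    linarith [norm_le_norm_sub_add s z]

theorem norm_exp_mul_binetKernel_le {δ t : ℝ} {z : ℂ} (hz : δ ≤ z.re) (ht : 0 < t) :
    ‖exp (-(z * t)) * ((binetKernel t / t : ℝ) : ℂ)‖ ≤ Real.exp (-δ * t) := by
  rw [norm_mul, norm_exp_neg_mul_ofReal, norm_real]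
  refine (mul_le_of_le_one_right (Real.exp_pos _).le (abs_binetKernel_div_le ht)).trans ?_
  gcongr
  nlinarith

theorem differentiableAt_integral_binetKernel {z : ℂ} (hz : 0 < z.re) :
    DifferentiableAt ℂ (fun z : ℂ =>
      ∫ t : ℝ in Ioi 0, exp (-(z * t)) * ((binetKernel t / t : ℝ) : ℂ)) z := by
  refine (hasDerivAt_integral_of_holomorphic (half_pos hz)
    (g := fun t => Real.exp (-(z.re / 2) * t)) (fun w _ => ?_) ?_ ?_ ?_).2.differentiableAt
  · have := measurable_binetKernel
    exact Measurable.aestronglyMeasurable (by fun_prop)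
  · exact Eventually.of_forall fun t => Differentiable.differentiableOn (by fun_prop)
  · refine (ae_restrict_iff' measurableSet_Ioi).2 (Eventually.of_forall fun t ht w hw => ?_)
    exact norm_exp_mul_binetKernel_le (by linarith [re_ball hw]) ht
  · exact integrableOn_exp_mul_Ioi (by linarith) 0

theorem differentiableAt_logSumRemainder (p : ℕ) {z : ℂ} (hz : 0 < z.re) :
    DifferentiableAt ℂ (logSumRemainder p) z := by
  have hlog : DifferentiableAt ℂ log z := (hasDerivAt_log (Or.inl hz)).differentiableAt
  rcases Nat.eq_zero_or_pos p with rfl | hp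
  · have : logSumRemainder 0 = fun z => -(log z) / 2 -
        ∫ t : ℝ in Ioi 0, exp (-(z * t)) * ((binetKernel t / t : ℝ) : ℂ) := by
      ext z; simp [logSumRemainder]
    rw [this]
    exact (hlog.neg.div_const 2).sub (differentiableAt_integral_binetKernel hz)
  · have : logSumRemainder p = fun z => planaIntegral p (fun w => log (z + w)) := by
      ext z; rw [logSumRemainder, if_neg (by lia)]
    rw [this]
    exact differentiableAt_planaIntegral_log hp hz

theorem differentiableAt_normalizedLogSum (p : ℕ) {z : ℂ} (hz : 0 < z.re) :
    DifferentiableAt ℂ (normalizedLogSum p) z := by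
  have hlog : DifferentiableAt ℂ log z := (hasDerivAt_log (Or.inl hz)).differentiableAt
  have hrem := differentiableAt_logSumRemainder p hz
  unfold normalizedLogSum logSum zetaCorrection
  fun_prop

/-- The shift `z ↦ z + 1` of the normalized sums, on the whole half-plane. -/
theorem normalizedLogSum_shift (p : ℕ) {z : ℂ} (hz : 0 < z.re) :
    normalizedLogSum p z = ∑ k ∈ Finset.range (p + 1), (p.choose k : ℂ) * (-1) ^ (p - k) *
      normalizedLogSum k (z + 1) - (-1) ^ p * log (z + 1) := by
  refine eqOn_re_pos_of_forall_ofReal (f := normalizedLogSum p) (g := fun z =>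
    ∑ k ∈ Finset.range (p + 1), (p.choose k : ℂ) * (-1) ^ (p - k) *
      normalizedLogSum k (z + 1) - (-1) ^ p * log (z + 1)) ?_ ?_
    (fun x hx => normalizedLogSum_shift_ofReal p hx) hz
  · exact fun z hz => (differentiableAt_normalizedLogSum p hz).differentiableWithinAt
  · intro z hz
    have hz' : 0 < z.re := hz
    have h1 : 0 < (z + 1).re := by simp; linarith
    refine DifferentiableAt.differentiableWithinAt (DifferentiableAt.sub
      (DifferentiableAt.fun_sum fun k _ => DifferentiableAt.const_mul ?_ _)
      (DifferentiableAt.const_mul ?_ _))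
    · exact DifferentiableAt.comp (g := normalizedLogSum k) (f := fun z : ℂ => z + 1) z
        (differentiableAt_normalizedLogSum k h1) (by fun_prop)
    · exact DifferentiableAt.clog (by fun_prop) (Or.inl h1)

/-- `f` grows at most like `‖z‖ ^ (N + 1 / 2)` on the half-plane `1 ≤ re z`. -/
def HasGrowth (N : ℕ) (f : ℂ → ℂ) : Prop :=
  ∃ C : ℝ, ∀ z : ℂ, 1 ≤ z.re → ‖f z‖ ≤ C * (‖z‖ ^ N * √‖z‖)

theorem HasGrowth.add {N : ℕ} {f g : ℂ → ℂ} (hf : HasGrowth N f) (hg : HasGrowth N g) :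
    HasGrowth N (fun z => f z + g z) := by
  obtain ⟨C, hC⟩ := hf
  obtain ⟨D, hD⟩ := hg
  refine ⟨C + D, fun z hz => ?_⟩
  rw [add_mul]
  exact (norm_add_le _ _).trans (add_le_add (hC z hz) (hD z hz))

theorem HasGrowth.const_mul {N : ℕ} {f : ℂ → ℂ} (hf : HasGrowth N f) (c : ℂ) :
    HasGrowth N (fun z => c * f z) := by
  obtain ⟨C, hC⟩ := hf
  refine ⟨‖c‖ * C, fun z hz => ?_⟩
  rw [norm_mul, mul_assoc]
  gcongr
  exact hC z hz

theorem HasGrowth.mono {N M : ℕ} (hNM : N ≤ M) {f : ℂ → ℂ} (hf : HasGrowth N f) :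
    HasGrowth M f := by
  obtain ⟨C, hC⟩ := hf
  refine ⟨|C|, fun z hz => (hC z hz).trans ?_⟩
  have h1 : 1 ≤ ‖z‖ := hz.trans (re_le_norm z)
  gcongr
  exact le_abs_self C

theorem HasGrowth.sum {ι : Type*} {N : ℕ} {f : ι → ℂ → ℂ} {s : Finset ι}
    (hf : ∀ i ∈ s, HasGrowth N (f i)) : HasGrowth N (fun z => ∑ i ∈ s, f i z) := by
  classical
  induction s using Finset.induction_on with
  | empty => exact ⟨0, fun z _ => by simp⟩
  | insert i s hi ih =>
    simp only [Finset.sum_insert hi]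
    exact (hf i (Finset.mem_insert_self i s)).add
      (ih fun j hj => hf j (Finset.mem_insert_of_mem hj))

theorem hasGrowth_of_norm_le {N : ℕ} {f : ℂ → ℂ} {C : ℝ}
    (hf : ∀ z : ℂ, 1 ≤ z.re → ‖f z‖ ≤ C * ‖z‖ ^ N) : HasGrowth N f := by
  refine ⟨|C|, fun z hz => (hf z hz).trans ?_⟩
  have h1 : 1 ≤ ‖z‖ := hz.trans (re_le_norm z)
  have h2 : 1 ≤ √‖z‖ := Real.one_le_sqrt.2 h1
  calc C * ‖z‖ ^ N ≤ |C| * (‖z‖ ^ N * 1) := by rw [mul_one]; gcongr; exact le_abs_self C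
    _ ≤ _ := by gcongr

theorem hasGrowth_pow {k N : ℕ} (hk : k ≤ N) : HasGrowth N (fun z => z ^ k) :=
  HasGrowth.mono hk (hasGrowth_of_norm_le (C := 1) fun z _ => by simp)

theorem hasGrowth_log : HasGrowth 0 log := by
  refine ⟨6, fun z hz => ?_⟩
  have h1 : 1 ≤ ‖z‖ := hz.trans (re_le_norm z)
  have h2 : 1 ≤ √‖z‖ := Real.one_le_sqrt.2 h1
  have h3 := Real.log_le_sub_one_of_pos (show 0 < √‖z‖ by positivity)
  rw [Real.log_sqrt (by positivity)] at h3
  have h4 : ‖log z‖ ≤ |(log z).re| + |(log z).im| := norm_le_abs_re_add_abs_im _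
  rw [log_re, log_im, abs_of_nonneg (Real.log_nonneg h1)] at h4
  have h5 := abs_arg_le_pi z
  rw [pow_zero, one_mul]
  linarith [Real.pi_lt_four]

theorem HasGrowth.pow_mul {N k : ℕ} {f : ℂ → ℂ} (hf : HasGrowth N f) :
    HasGrowth (k + N) (fun z => z ^ k * f z) := by
  obtain ⟨C, hC⟩ := hf
  refine ⟨C, fun z hz => ?_⟩
  rw [norm_mul, norm_pow, pow_add]
  calc ‖z‖ ^ k * ‖f z‖ ≤ ‖z‖ ^ k * (C * (‖z‖ ^ N * √‖z‖)) := by gcongr; exact hC z hz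
    _ = _ := by ring

theorem hasGrowth_logSumRemainder (p : ℕ) : HasGrowth 1 (logSumRemainder p) := by
  rcases Nat.eq_zero_or_pos p with rfl | hp
  · have : logSumRemainder 0 = fun z => (-1 / 2) * log z +
        (-1) * ∫ t : ℝ in Ioi 0, exp (-(z * t)) * ((binetKernel t / t : ℝ) : ℂ) := by
      ext z; simp [logSumRemainder]; ring
    rw [this]
    refine ((hasGrowth_log.const_mul _).add (HasGrowth.const_mul ?_ _)).mono zero_le_one
    refine hasGrowth_of_norm_le (C := 1) fun z hz => ?_
    have h := norm_integral_le_of_norm_le (μ := volume.restrict (Ioi (0 : ℝ)))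
      (integrableOn_exp_mul_Ioi (a := -1) (by norm_num) 0)
      ((ae_restrict_iff' measurableSet_Ioi).2 (Eventually.of_forall fun t ht =>
        norm_exp_mul_binetKernel_le hz ht))
    refine h.trans ?_
    rw [integral_exp_mul_Ioi (by norm_num)]
    simp
  · have : logSumRemainder p = fun z => planaIntegral p (fun w => log (z + w)) := by
      ext z; rw [logSumRemainder, if_neg (by lia)]
    rw [this]
    refine hasGrowth_of_norm_le
      (C := ∫ x : ℝ in Ioi 0, 14 * ((1 + x) ^ (1 + p) * Real.exp (-(Real.pi * x)))) fun z hz => ?_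
    have h1 : 1 ≤ ‖z‖ := hz.trans (re_le_norm z)
    have hz0 : 0 < z.re := by linarith
    rw [planaIntegral, norm_mul, norm_I, one_mul, pow_one, ← integral_mul_const]
    refine norm_integral_le_of_norm_le
      (((integrableOn_one_add_pow_mul_exp (1 + p)).const_mul 14).mul_const _)
      ((ae_restrict_iff' measurableSet_Ioi).2 (Eventually.of_forall fun x hx => ?_))
    have hx' : (0 : ℝ) < x := hx
    have hinv : z.re⁻¹ ≤ 1 := inv_le_one_of_one_le₀ hz
    have hb : ∀ y : ℝ, |y| = x → ‖log (z + I * y)‖ ≤ 7 * ‖z‖ * (1 + x) ^ 1 := by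
      intro y hy
      refine (norm_log_add_I_mul_le hz0 y).trans ?_
      rw [hy]
      gcongr
      linarith
    refine (norm_planaIntegrand_le hp hx' (c := 7 * ‖z‖ * (1 + x) ^ 1) (hb x (abs_of_pos hx')) ?_).trans_eq
      (by ring)
    simpa using hb (-x) (by rw [abs_neg, abs_of_pos hx'])

theorem hasGrowth_normalizedLogSum (p : ℕ) : HasGrowth (p + 1) (normalizedLogSum p) := by
  have h1 : HasGrowth (p + 1) (fun z => z ^ (p + 1) * log z) := hasGrowth_log.pow_mul
  have h2 : HasGrowth (p + 1) (fun z => z ^ (p + 1)) := hasGrowth_pow le_rfl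
  have h3 := (hasGrowth_logSumRemainder p).mono (show 1 ≤ p + 1 by lia)
  have h4 : HasGrowth (p + 1) (fun z => ∑ k ∈ Finset.range (p + 1),
      -((-1) ^ k * (p.choose k : ℂ) * deriv riemannZeta (-(k : ℂ))) * z ^ (p - k)) :=
    HasGrowth.sum fun k _ => (hasGrowth_pow (by lia)).const_mul _
  have h5 := (((h1.const_mul (1 / (p + 1))).add
    (h2.const_mul (-((harmonic (p + 1) : ℚ) : ℂ) / (p + 1)))).add
    (h3.const_mul (-(-1) ^ p))).add h4
  convert h5 using 2 with z
  rw [normalizedLogSum, logSum, zetaCorrection, ← Finset.sum_neg_distrib]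
  simp only [neg_mul]
  have hsq : ((-1 : ℂ) ^ p) * (-1) ^ p = 1 := by rw [← mul_pow]; simp
  rw [pow_succ (-1 : ℂ) p]
  linear_combination (z ^ (p + 1) * (log z - ((harmonic (p + 1) : ℚ) : ℂ)) / (p + 1)) * hsq

/-! ### Binomial combinations and the logarithms of the multiple gamma functions -/

theorem umbral_eq_sum (a : ℕ → ℂ) (q : Polynomial ℂ) :
    umbral a q = ∑ i ∈ Finset.range (q.natDegree + 1), q.coeff i * a i := by
  conv_lhs => rw [q.as_sum_range_C_mul_X_pow]
  rw [map_sum]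
  refine Finset.sum_congr rfl fun i _ => ?_
  rw [← Polynomial.smul_eq_C_mul, map_smul, umbral_X_pow, smul_eq_mul]

/-- The recurrence of the normalized sums, for arbitrary polynomial weights:
`-∑_{j ≥ 1} q(-j) log (z + j)` loses its first term under `z ↦ z + 1`. -/
theorem umbral_normalizedLogSum_shift {z : ℂ} (hz : 0 < z.re) (q : Polynomial ℂ) :
    umbral (fun p => normalizedLogSum p z) q =
      umbral (fun p => normalizedLogSum p (z + 1)) (q.comp (Polynomial.X - 1)) -
        q.eval (-1) * log (z + 1) := by
  induction q using Polynomial.induction_on' with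
  | add q r hq hr =>
    rw [map_add, hq, hr, Polynomial.add_comp, map_add, Polynomial.eval_add]
    ring
  | monomial n c =>
    rw [← Polynomial.C_mul_X_pow_eq_monomial, ← Polynomial.smul_eq_C_mul, map_smul,
      Polynomial.smul_comp, map_smul, Polynomial.eval_smul, Polynomial.X_pow_comp, umbral_X_pow,
      Polynomial.eval_pow, Polynomial.eval_X, normalizedLogSum_shift n hz,
      sub_eq_add_neg Polynomial.X, add_pow, map_sum, smul_eq_mul, smul_eq_mul, smul_eq_mul, mul_sub,
      mul_assoc]
    congr 2
    refine Finset.sum_congr rfl fun k _ => ?_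
    rw [show (Polynomial.X : Polynomial ℂ) ^ k * (-1) ^ (n - k) * (n.choose k : Polynomial ℂ) =
      ((n.choose k : ℂ) * (-1) ^ (n - k)) • Polynomial.X ^ k by
        rw [Polynomial.smul_eq_C_mul]
        simp only [map_mul, map_pow, map_neg, map_one, map_natCast]
        ring]
    rw [map_smul, umbral_X_pow, smul_eq_mul]

theorem descPochhammer_eval_neg_one (k : ℕ) :
    (descPochhammer ℂ k).eval (-1) = (-1) ^ k * k.factorial := by
  induction k with
  | zero => simp
  | succ k ih =>
    rw [descPochhammer_succ_eval, ih, Nat.factorial_succ]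
    push_cast
    ring

/-- The falling factorials expand monomials with the Stirling subset numbers as coefficients. -/
theorem X_pow_eq_sum_stirlingSecond (p : ℕ) :
    (Polynomial.X ^ p : Polynomial ℂ) =
      ∑ k ∈ Finset.range (p + 1), (Nat.stirlingSecond p k : ℂ) • descPochhammer ℂ k := by
  induction p with
  | zero => simp
  | succ p ih =>
    have h1 : ∀ k : ℕ, descPochhammer ℂ k * Polynomial.X =
        descPochhammer ℂ (k + 1) + (k : ℂ) • descPochhammer ℂ k := by
      intro k
      rw [descPochhammer_succ_right, Polynomial.smul_eq_C_mul, map_natCast]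
      ring
    have h2 : ∑ k ∈ Finset.range (p + 1), ((Nat.stirlingSecond p k : ℂ) * k) • descPochhammer ℂ k =
        ∑ k ∈ Finset.range (p + 1), ((Nat.stirlingSecond p (k + 1) : ℂ) * (k + 1)) •
          descPochhammer ℂ (k + 1) := by
      rw [Finset.sum_range_succ', Finset.sum_range_succ _ p,
        Nat.stirlingSecond_eq_zero_of_lt (Nat.lt_succ_self p)]
      simp
    rw [pow_succ, ih, Finset.sum_mul, Finset.sum_range_succ' _ (p + 1)]
    simp only [smul_mul_assoc, h1, smul_add, Finset.sum_add_distrib, smul_smul, h2,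
      Nat.stirlingSecond_succ_succ]
    rw [← Finset.sum_add_distrib]
    simp only [← add_smul, Nat.stirlingSecond_succ_zero, Nat.cast_zero, zero_smul, add_zero]
    refine Finset.sum_congr rfl fun k _ => ?_
    push_cast
    ring_nf

/-- The regularized sum `-∑_{j ≥ 1} (j + k - 1 choose k) log (z + j)`; this is
`log Γ_{k + 1} (z + 1)`. -/
noncomputable def chooseLogSum (k : ℕ) (z : ℂ) : ℂ :=
  (-1) ^ k / k.factorial * umbral (fun p => normalizedLogSum p z) (descPochhammer ℂ k)

theorem chooseLogSum_eq_sum (k : ℕ) (z : ℂ) :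
    chooseLogSum k z = ∑ i ∈ Finset.range (k + 1),
      ((-1) ^ k / k.factorial * (descPochhammer ℂ k).coeff i) * normalizedLogSum i z := by
  rw [chooseLogSum, umbral_eq_sum, descPochhammer_natDegree, Finset.mul_sum]
  exact Finset.sum_congr rfl fun i _ => by ring

theorem chooseLogSum_one (k : ℕ) : chooseLogSum k 1 = 0 := by
  rw [chooseLogSum_eq_sum]
  exact Finset.sum_eq_zero fun i _ => by rw [normalizedLogSum_one, mul_zero]

theorem differentiableAt_chooseLogSum (k : ℕ) {z : ℂ} (hz : 0 < z.re) :
    DifferentiableAt ℂ (chooseLogSum k) z := by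
  rw [show chooseLogSum k = _ from funext (chooseLogSum_eq_sum k)]
  exact DifferentiableAt.fun_sum fun i _ => (differentiableAt_normalizedLogSum i hz).const_mul _

theorem hasGrowth_chooseLogSum (k : ℕ) : HasGrowth (k + 1) (chooseLogSum k) := by
  rw [show chooseLogSum k = _ from funext (chooseLogSum_eq_sum k)]
  exact HasGrowth.sum fun i hi => ((hasGrowth_normalizedLogSum i).mono
    (by have := Finset.mem_range_succ_iff.1 hi; lia)).const_mul _

theorem chooseLogSum_zero_shift {z : ℂ} (hz : 0 < z.re) :
    chooseLogSum 0 (z + 1) = chooseLogSum 0 z + log (z + 1) := by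
  have h := umbral_normalizedLogSum_shift hz (descPochhammer ℂ 0)
  simp only [descPochhammer_zero, Polynomial.one_comp, Polynomial.eval_one] at h
  simp only [chooseLogSum, descPochhammer_zero]
  rw [h]
  simp

theorem chooseLogSum_succ_shift (k : ℕ) {z : ℂ} (hz : 0 < z.re) :
    chooseLogSum (k + 1) (z + 1) = chooseLogSum (k + 1) z - chooseLogSum k z := by
  have h := umbral_normalizedLogSum_shift hz (descPochhammer ℂ (k + 1))
  have h' := umbral_normalizedLogSum_shift hz (descPochhammer ℂ k)
  have hsmul : ∀ q : Polynomial ℂ, ((k : Polynomial ℂ) + 1) • q = ((k : ℂ) + 1) • q := by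
    intro q
    rw [Polynomial.smul_eq_C_mul, smul_eq_mul]
    simp
  rw [descPochhammer_succ_comp_X_sub_one, hsmul, map_sub, map_smul, descPochhammer_eval_neg_one,
    smul_eq_mul] at h
  rw [descPochhammer_eval_neg_one] at h'
  simp only [chooseLogSum]
  rw [h, h', Nat.factorial_succ]
  have h1 : (k.factorial : ℂ) ≠ 0 := by exact_mod_cast k.factorial_ne_zero
  have h2 : (k : ℂ) + 1 ≠ 0 := by exact_mod_cast k.succ_ne_zero
  have hsq : ((-1 : ℂ) ^ k) * (-1) ^ k = 1 := by rw [← mul_pow]; simp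
  push_cast
  rw [pow_succ]
  field_simp
  ring

theorem normalizedLogSum_eq_sum_chooseLogSum (p : ℕ) (z : ℂ) :
    normalizedLogSum p z = ∑ k ∈ Finset.range (p + 1),
      (-1) ^ k * (k.factorial : ℂ) * (Nat.stirlingSecond p k : ℂ) * chooseLogSum k z := by
  rw [← umbral_X_pow (fun p => normalizedLogSum p z) p, X_pow_eq_sum_stirlingSecond, map_sum]
  refine Finset.sum_congr rfl fun k _ => ?_
  have h1 : (k.factorial : ℂ) ≠ 0 := by exact_mod_cast k.factorial_ne_zero
  have hsq : ((-1 : ℂ) ^ k) * (-1) ^ k = 1 := by rw [← mul_pow]; simp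
  rw [map_smul, smul_eq_mul, chooseLogSum]
  field_simp
  linear_combination (-(Nat.stirlingSecond p k : ℂ) *
    umbral (fun p => normalizedLogSum p z) (descPochhammer ℂ k)) * hsq

/-- The logarithm of the multiple gamma function `Γ_N` on the right half-plane; for `N = 0` this is
`-log`, so that `Γ₀(z) = 1 / z`. -/
noncomputable def logGamma (N : ℕ) (w : ℂ) : ℂ :=
  -log w + ∑ k ∈ Finset.range N, chooseLogSum k w

theorem logGamma_succ_add_one (N : ℕ) {z : ℂ} (hz : 0 < z.re) :
    logGamma (N + 1) (z + 1) = chooseLogSum N z := by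
  induction N with
  | zero => simp [logGamma, chooseLogSum_zero_shift hz]
  | succ N ih =>
    rw [logGamma, Finset.sum_range_succ, ← add_assoc]
    rw [logGamma] at ih
    rw [ih, chooseLogSum_succ_shift N hz]
    ring

theorem logGamma_shift (N : ℕ) {z : ℂ} (hz : 0 < z.re) :
    logGamma (N + 1) (z + 1) = logGamma (N + 1) z - logGamma N z := by
  rw [logGamma_succ_add_one N hz, logGamma, logGamma, Finset.sum_range_succ]
  ring

theorem logGamma_one (N : ℕ) : logGamma N 1 = 0 := by
  simp [logGamma, chooseLogSum_one]

theorem differentiableAt_logGamma (N : ℕ) {z : ℂ} (hz : 0 < z.re) :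
    DifferentiableAt ℂ (logGamma N) z :=
  (hasDerivAt_log (Or.inl hz)).differentiableAt.neg.add
    (DifferentiableAt.fun_sum fun k _ => differentiableAt_chooseLogSum k hz)

theorem hasGrowth_logGamma (N : ℕ) : HasGrowth N (logGamma N) := by
  have h : HasGrowth N (fun z => (-1) * log z + ∑ k ∈ Finset.range N, chooseLogSum k z) :=
    ((hasGrowth_log.mono N.zero_le).const_mul (-1)).add
      (HasGrowth.sum fun k hk => (hasGrowth_chooseLogSum k).mono
        (by have := Finset.mem_range.1 hk; lia))
  convert h using 2 with z
  rw [logGamma, neg_one_mul]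

/-! ### Signs and uniqueness principles for iterated derivatives -/

/-- By the Cauchy estimates, derivatives of order greater than the growth exponent decay. -/
theorem HasGrowth.tendsto_iteratedDeriv {N m : ℕ} (hm : N + 1 ≤ m) {f : ℂ → ℂ}
    (hf : ∀ z : ℂ, 0 < z.re → DifferentiableAt ℂ f z) (hg : HasGrowth N f) :
    Tendsto (fun x : ℝ => iteratedDeriv m f x) atTop (𝓝 0) := by
  obtain ⟨C, hC⟩ := hg
  set K : ℝ := m.factorial * |C| * 2 ^ N * √2 * 2 ^ (N + 1) with hK
  have hlim : Tendsto (fun x : ℝ => K * (√x)⁻¹) atTop (𝓝 0) := by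
    simpa using (tendsto_inv_atTop_zero.comp Real.tendsto_sqrt_atTop).const_mul K
  refine squeeze_zero_norm' ?_ hlim
  filter_upwards [eventually_ge_atTop 2] with x hx
  have hx0 : 0 < x := by linarith
  have hball : ∀ w ∈ Metric.closedBall (x : ℂ) (x / 2), x / 2 ≤ w.re ∧ ‖w‖ ≤ 2 * x := by
    intro w hw
    have h1 : ‖w - x‖ ≤ x / 2 := by simpa [dist_eq] using hw
    have h2 := (abs_re_le_norm _).trans h1
    rw [sub_re, ofReal_re, abs_le] at h2
    have h3 := norm_le_norm_sub_add w x
    rw [norm_real, Real.norm_of_nonneg hx0.le] at h3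
    constructor <;> linarith [h2.1]
  have h := norm_iteratedDeriv_le_of_forall_mem_sphere_norm_le (c := (x : ℂ)) (R := x / 2) (f := f) m
    (by positivity) (C := |C| * ((2 * x) ^ N * √(2 * x))) ?_ ?_
  · refine h.trans ?_
    have h1 : (x / 2) ^ (N + 1) ≤ (x / 2) ^ m := pow_le_pow_right₀ (by linarith) hm
    calc (m.factorial : ℝ) * (|C| * ((2 * x) ^ N * √(2 * x))) / (x / 2) ^ m
        ≤ m.factorial * (|C| * ((2 * x) ^ N * √(2 * x))) / (x / 2) ^ (N + 1) := by gcongr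
      _ = K * (√x)⁻¹ := by
          have hs : √x * √x = x := Real.mul_self_sqrt hx0.le
          have hs0 : √x ≠ 0 := (Real.sqrt_pos.2 hx0).ne'
          rw [hK, Real.sqrt_mul (by norm_num), div_pow, mul_pow]
          field_simp
          rw [pow_succ x, sq, hs]
          ring
  · have hU : DifferentiableOn ℂ f {z : ℂ | 0 < z.re} := fun z hz =>
      (hf z hz).differentiableWithinAt
    refine hU.diffContOnCl_ball fun w hw => ?_
    exact lt_of_lt_of_le (by positivity) (hball w hw).1
  · intro w hw
    obtain ⟨h1, h2⟩ := hball w (Metric.sphere_subset_closedBall hw)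
    refine (hC w (by linarith)).trans ?_
    gcongr
    exact le_abs_self C

theorem contDiffAt_of_re_pos {f : ℂ → ℂ} (hf : ∀ z : ℂ, 0 < z.re → DifferentiableAt ℂ f z) {z : ℂ}
    (hz : 0 < z.re) {n : WithTop ℕ∞} : ContDiffAt ℂ n f z := by
  have h : DifferentiableOn ℂ f {z | 0 < z.re} := fun z hz => (hf z hz).differentiableWithinAt
  exact (h.analyticAt (isOpen_re_pos.mem_nhds hz)).contDiffAt

theorem differentiableAt_iteratedDeriv {𝕜 : Type*} [RCLike 𝕜] {f : 𝕜 → 𝕜} {x : 𝕜}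
    (h : ContDiffAt 𝕜 ⊤ f x) (m : ℕ) : DifferentiableAt 𝕜 (iteratedDeriv m f) x := by
  rw [iteratedDeriv_eq_iterate]
  exact (h.analyticAt.iterated_deriv m).differentiableAt

theorem iteratedDeriv_shift {f g : ℂ → ℂ} (hf : ∀ z : ℂ, 0 < z.re → DifferentiableAt ℂ f z)
    (hg : ∀ z : ℂ, 0 < z.re → DifferentiableAt ℂ g z)
    (h : ∀ z : ℂ, 0 < z.re → f (z + 1) = f z - g z) (m : ℕ) {z : ℂ} (hz : 0 < z.re) :
    iteratedDeriv m f (z + 1) = iteratedDeriv m f z - iteratedDeriv m g z := by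
  rw [← iteratedDeriv_fun_sub (contDiffAt_of_re_pos hf hz) (contDiffAt_of_re_pos hg hz),
    ← congrFun (iteratedDeriv_comp_add_const m f 1) z]
  refine Filter.EventuallyEq.iteratedDeriv_eq m ?_
  filter_upwards [isOpen_re_pos.mem_nhds hz] with w hw using h w hw

theorem iteratedDeriv_logGamma_zero (m : ℕ) {x : ℝ} (hx : 0 < x) :
    (-1) ^ (m + 1) * iteratedDeriv (m + 1) (logGamma 0) x =
      ((m.factorial * x ^ (-1 - m : ℤ) : ℝ) : ℂ) := by
  have h1 : deriv (logGamma 0) =ᶠ[𝓝 (x : ℂ)] fun z => -z⁻¹ := by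
    filter_upwards [isOpen_re_pos.mem_nhds (show 0 < (x : ℂ).re by simpa using hx)] with z hz
    have h2 : HasDerivAt (logGamma 0) (-z⁻¹) z := by
      have : logGamma 0 = fun z => -log z := by ext z; simp [logGamma]
      rw [this]
      exact (hasDerivAt_log (Or.inl hz)).fun_neg
    exact h2.deriv
  rw [iteratedDeriv_succ', h1.iteratedDeriv_eq m, iteratedDeriv_fun_neg, iteratedDeriv_eq_iterate,
    iter_deriv_inv']
  have hsq : ((-1 : ℂ) ^ m) * (-1) ^ m = 1 := by rw [← mul_pow]; simp
  push_cast
  rw [pow_succ]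
  linear_combination (m.factorial * (x : ℂ) ^ (-1 - m : ℤ)) * hsq

theorem iteratedDeriv_logGamma_succ (N m : ℕ) {z : ℂ} (hz : 0 < z.re) :
    iteratedDeriv m (logGamma (N + 1)) (z + 1) =
      iteratedDeriv m (logGamma (N + 1)) z - iteratedDeriv m (logGamma N) z :=
  iteratedDeriv_shift (fun _ => differentiableAt_logGamma (N + 1))
    (fun _ => differentiableAt_logGamma N) (fun _ => logGamma_shift N) m hz

theorem tendsto_iteratedDeriv_logGamma {N m : ℕ} (hm : N + 1 ≤ m) :
    Tendsto (fun x : ℝ => iteratedDeriv m (logGamma N) x) atTop (𝓝 0) :=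
  (hasGrowth_logGamma N).tendsto_iteratedDeriv hm fun _ => differentiableAt_logGamma N

theorem tendsto_iteratedDeriv_logGamma_add_nat {N m : ℕ} (hm : N + 1 ≤ m) (x : ℝ) :
    Tendsto (fun n : ℕ => iteratedDeriv m (logGamma N) ((x : ℂ) + n)) atTop (𝓝 0) := by
  have h := (tendsto_iteratedDeriv_logGamma hm).comp
    (tendsto_atTop_add_const_left _ x tendsto_natCast_atTop_atTop)
  refine h.congr fun n => ?_
  simp

/-- The signs of the derivatives of `log Γ_N` of order greater than `N`: they decay, and their
differences under `x ↦ x + 1` are the derivatives of `log Γ_{N - 1}`. -/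
theorem iteratedDeriv_logGamma_nonneg (N : ℕ) {m : ℕ} (hm : N + 1 ≤ m) {x : ℝ} (hx : 0 < x) :
    0 ≤ ((-1) ^ m * iteratedDeriv m (logGamma N) x).re := by
  induction N generalizing m x with
  | zero =>
    obtain ⟨k, rfl⟩ := Nat.exists_eq_add_of_le' hm
    rw [zero_add, iteratedDeriv_logGamma_zero k hx, ofReal_re]
    positivity
  | succ N ih =>
    have hlim : Tendsto (fun n : ℕ =>
        ((-1) ^ m * iteratedDeriv m (logGamma (N + 1)) ((x : ℂ) + n)).re) atTop (𝓝 0) := by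
      have h := (tendsto_iteratedDeriv_logGamma_add_nat hm x).const_mul ((-1 : ℂ) ^ m)
      rw [mul_zero] at h
      exact (continuous_re.tendsto' 0 0 rfl).comp h
    have hanti : Antitone (fun n : ℕ =>
        ((-1) ^ m * iteratedDeriv m (logGamma (N + 1)) ((x : ℂ) + n)).re) := by
      refine antitone_nat_of_succ_le fun n => ?_
      have hpos : 0 < x + n := by positivity
      have h := ih (by lia : N + 1 ≤ m) hpos
      push_cast at h
      rw [Nat.cast_succ, ← add_assoc, iteratedDeriv_logGamma_succ N m
        (by simpa using hpos), mul_sub, sub_re]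
      linarith
    simpa using hanti.le_of_tendsto hlim 0

/-- Real parts commute with iterated derivatives along the positive half-line. -/
theorem iteratedDeriv_re {f : ℂ → ℂ} (hf : ∀ z : ℂ, 0 < z.re → DifferentiableAt ℂ f z) (m : ℕ)
    {x : ℝ} (hx : 0 < x) :
    iteratedDeriv m (fun y : ℝ => (f y).re) x = (iteratedDeriv m f x).re := by
  induction m generalizing x with
  | zero => simp
  | succ m ih =>
    have h1 : iteratedDeriv m (fun y : ℝ => (f y).re) =ᶠ[𝓝 x]
        fun y : ℝ => (iteratedDeriv m f y).re := by
      filter_upwards [Ioi_mem_nhds hx] with y hy using ih hy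
    rw [iteratedDeriv_succ, h1.deriv_eq, iteratedDeriv_succ]
    refine HasDerivAt.deriv ?_
    have h2 : DifferentiableAt ℂ (iteratedDeriv m f) x := by
      exact differentiableAt_iteratedDeriv (contDiffAt_of_re_pos hf (by simpa using hx)) m
    exact h2.hasDerivAt.real_of_complex

theorem contDiffAt_re {f : ℂ → ℂ} (hf : ∀ z : ℂ, 0 < z.re → DifferentiableAt ℂ f z)
    {x : ℝ} (hx : 0 < x) {n : WithTop ℕ∞} : ContDiffAt ℝ n (fun y : ℝ => (f y).re) x :=
  (contDiffAt_of_re_pos hf (by simpa using hx)).real_of_complex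

/-- A function on the positive half-line with period `1`. -/
def PeriodicOnPos (d : ℝ → ℝ) : Prop := ∀ x : ℝ, 0 < x → d (x + 1) = d x

theorem PeriodicOnPos.iteratedDeriv {d : ℝ → ℝ} (h : PeriodicOnPos d) (m : ℕ) :
    PeriodicOnPos (iteratedDeriv m d) := by
  intro x hx
  rw [← congrFun (iteratedDeriv_comp_add_const m d 1) x]
  refine Filter.EventuallyEq.iteratedDeriv_eq m ?_
  filter_upwards [Ioi_mem_nhds hx] with y hy using h y hy

theorem PeriodicOnPos.add_nat {d : ℝ → ℝ} (h : PeriodicOnPos d) {x : ℝ} (hx : 0 < x) (n : ℕ) :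
    d (x + n) = d x := by
  induction n with
  | zero => simp
  | succ n ih => rw [Nat.cast_succ, ← add_assoc, h _ (by positivity), ih]

/-- A periodic function with a constant derivative of some order is constant. -/
theorem PeriodicOnPos.const_of_iteratedDeriv_const {d : ℝ → ℝ} (h : PeriodicOnPos d)
    (hd : ∀ x : ℝ, 0 < x → ContDiffAt ℝ ⊤ d x) (m : ℕ) {c : ℝ}
    (hc : ∀ x : ℝ, 0 < x → _root_.iteratedDeriv m d x = c) :
    ∃ c' : ℝ, ∀ x : ℝ, 0 < x → d x = c' := by
  induction m generalizing c with
  | zero => exact ⟨c, fun x hx => by simpa using hc x hx⟩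
  | succ m ih =>
    have hdiff : ∀ x : ℝ, 0 < x → HasDerivAt (_root_.iteratedDeriv m d) c x := by
      intro x hx
      have h1 : DifferentiableAt ℝ (_root_.iteratedDeriv m d) x :=
        differentiableAt_iteratedDeriv (hd x hx) m
      rw [← hc x hx, iteratedDeriv_succ]
      exact h1.hasDerivAt
    have hlin : ∀ x : ℝ, 0 < x → _root_.iteratedDeriv m d x - c * x =
        _root_.iteratedDeriv m d 1 - c * 1 := by
      intro x hx
      have hg : ∀ y ∈ Ioi (0 : ℝ),
          HasDerivAt (fun y => _root_.iteratedDeriv m d y - c * y) 0 y := by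
        intro y hy
        simpa using (hdiff y hy).fun_sub ((hasDerivAt_id y).const_mul c)
      exact isOpen_Ioi.is_const_of_deriv_eq_zero isPreconnected_Ioi
        (fun y hy => (hg y hy).differentiableAt.differentiableWithinAt)
        (fun y hy => (hg y hy).deriv) (mem_Ioi.2 hx) (mem_Ioi.2 one_pos)
    have hc0 : c = 0 := by
      have h1 := hlin (1 + 1) (by norm_num)
      rw [h.iteratedDeriv m 1 one_pos] at h1
      linarith
    refine ih (c := _root_.iteratedDeriv m d 1) fun x hx => ?_
    have h1 := hlin x hx
    rw [hc0] at h1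
    linarith

/-- Reality on the positive half-line: the imaginary part is periodic, and its derivatives of high
order decay, so that it is constant. -/
theorem logGamma_im (N : ℕ) {x : ℝ} (hx : 0 < x) : (logGamma N x).im = 0 := by
  induction N generalizing x with
  | zero => simp [logGamma, log_im, arg_ofReal_of_nonneg hx.le]
  | succ N ih =>
    have hf : ∀ z : ℂ, 0 < z.re → DifferentiableAt ℂ (fun z => -I * logGamma (N + 1) z) z :=
      fun z hz => (differentiableAt_logGamma (N + 1) hz).const_mul _
    have him : ∀ z : ℂ, (-I * logGamma (N + 1) z).re = (logGamma (N + 1) z).im := by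
      intro z; simp
    have hper : PeriodicOnPos (fun y : ℝ => (-I * logGamma (N + 1) y).re) := by
      intro y hy
      simp only [him]
      push_cast
      rw [logGamma_shift N (by simpa using hy), sub_im, ih hy, sub_zero]
    have hzero : ∀ y : ℝ, 0 < y →
        iteratedDeriv (N + 2) (fun y : ℝ => (-I * logGamma (N + 1) y).re) y = 0 := by
      intro y hy
      have hlim : Tendsto (fun n : ℕ =>
          iteratedDeriv (N + 2) (fun y : ℝ => (-I * logGamma (N + 1) y).re) (y + n)) atTop (𝓝 0) := by
        have h1 := ((tendsto_iteratedDeriv_logGamma_add_nat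
          (show N + 1 + 1 ≤ N + 2 by lia) y).const_mul (-I))
        rw [mul_zero] at h1
        refine ((continuous_re.tendsto' 0 0 rfl).comp h1).congr fun n => ?_
        rw [iteratedDeriv_re hf _ (show 0 < y + n by positivity)]
        push_cast
        rw [iteratedDeriv_const_mul_field]
        rfl
      refine tendsto_nhds_unique (tendsto_const_nhds.congr fun n => ?_) hlim
      exact ((hper.iteratedDeriv (N + 2)).add_nat hy n).symm
    obtain ⟨c, hc⟩ := hper.const_of_iteratedDeriv_const (fun y hy => contDiffAt_re hf hy) _ hzero
    have h1 := hc 1 one_pos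
    have h2 := hc x hx
    simp only [him] at h1 h2
    rw [h2, ← h1, ofReal_one, logGamma_one, zero_im]

theorem logGamma_ofReal (N : ℕ) {x : ℝ} (hx : 0 < x) :
    logGamma N x = ((logGamma N x).re : ℂ) :=
  Complex.ext (by simp) (by simp [logGamma_im N hx])

theorem exp_logGamma_zero {z : ℂ} (hz : 0 < z.re) : exp (logGamma 0 z) = z⁻¹ := by
  have : z ≠ 0 := by rintro rfl; simp at hz
  simp [logGamma, exp_neg, exp_log this]

/-- `Γ₁` is the Euler gamma function, by the Bohr-Mollerup theorem. -/
theorem exp_logGamma_one_eq {z : ℂ} (hz : 0 < z.re) : exp (logGamma 1 z) = Gamma z := by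
  have hre : ∀ x : ℝ, 0 < x → exp (logGamma 1 x) = (Real.exp (logGamma 1 x).re : ℂ) := by
    intro x hx
    rw [ofReal_exp, ← logGamma_ofReal 1 hx]
  have hf : ∀ z : ℂ, 0 < z.re → DifferentiableAt ℂ (logGamma 1) z :=
    fun _ => differentiableAt_logGamma 1
  have hBM : EqOn (fun x : ℝ => Real.exp (logGamma 1 x).re) Real.Gamma (Ioi 0) := by
    refine Real.eq_Gamma_of_log_convex ?_ ?_ (fun _ => Real.exp_pos _) (by simp [logGamma_one])
    · have : Real.log ∘ (fun x : ℝ => Real.exp (logGamma 1 x).re) =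
          fun x : ℝ => (logGamma 1 x).re := by ext x; simp
      rw [this]
      have hc : ∀ x : ℝ, x ∈ Ioi (0 : ℝ) →
          ContDiffAt ℝ ⊤ (fun x : ℝ => (logGamma 1 x).re) x := fun x hx => contDiffAt_re hf hx
      refine convexOn_of_deriv2_nonneg (convex_Ioi 0) ?_ ?_ ?_ ?_
      · exact fun x hx => (hc x hx).continuousAt.continuousWithinAt
      · rw [interior_Ioi]
        exact fun x hx => ((hc x hx).differentiableAt (by simp)).differentiableWithinAt
      · rw [interior_Ioi]
        intro x hx
        have h1 := differentiableAt_iteratedDeriv (hc x hx) 1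
        rw [iteratedDeriv_one] at h1
        exact h1.differentiableWithinAt
      · rw [interior_Ioi]
        intro x hx
        rw [← iteratedDeriv_eq_iterate, iteratedDeriv_re hf 2 hx]
        simpa using iteratedDeriv_logGamma_nonneg 1 (m := 2) le_rfl hx
    · intro y hy
      have h := logGamma_shift 0 (z := y) (by simpa using hy)
      simp only [zero_add] at h
      push_cast
      rw [h, sub_re, Real.exp_sub]
      have h0 : (logGamma 0 y).re = -Real.log y := by
        simp [logGamma, log_re, abs_of_pos hy]
      rw [h0, Real.exp_neg, Real.exp_log hy]
      field_simp
  refine eqOn_re_pos_of_forall_ofReal (f := fun z => exp (logGamma 1 z)) (g := Gamma) ?_ ?_ ?_ hz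
  · exact fun z hz => (hf z hz).cexp.differentiableWithinAt
  · intro z hz
    refine (differentiableAt_Gamma z fun m h => ?_).differentiableWithinAt
    have hz' : 0 < z.re := hz
    rw [h] at hz'
    simp at hz'
    linarith [m.cast_nonneg (α := ℝ)]
  · intro x hx
    rw [hre x hx, Gamma_ofReal]
    exact congrArg _ (hBM (mem_Ioi.2 hx))

/-! ### Existence and uniqueness of the multiple gamma functions -/

/-- A holomorphic function on the right half-plane that satisfies `f z = f (z + 1) * h z` with an
entire `h` extends to an entire function, by iterating the functional equation. -/
theorem exists_entire_extension {f h : ℂ → ℂ} (hf : ∀ z : ℂ, 0 < z.re → DifferentiableAt ℂ f z)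
    (hh : Differentiable ℂ h) (hfh : ∀ z : ℂ, 0 < z.re → f z = f (z + 1) * h z) :
    ∃ F : ℂ → ℂ, Differentiable ℂ F ∧ ∀ z : ℂ, 0 < z.re → F z = f z := by
  set G : ℕ → ℂ → ℂ := fun n z => f (z + n) * ∏ j ∈ Finset.range n, h (z + j) with hG
  have hstep : ∀ (n : ℕ) (z : ℂ), 0 < z.re + n → G (n + 1) z = G n z := by
    intro n z hz
    simp only [hG]
    rw [Finset.prod_range_succ, hfh (z + n) (by simpa using hz)]
    push_cast
    rw [← add_assoc]
    ring
  have hle : ∀ (n k : ℕ) (z : ℂ), 0 < z.re + n → G (n + k) z = G n z := by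
    intro n k z hz
    induction k with
    | zero => rfl
    | succ k ih =>
      rw [← add_assoc, hstep _ _ (by push_cast; linarith [k.cast_nonneg (α := ℝ)]), ih]
  have hdiff : ∀ (n : ℕ) (z : ℂ), 0 < z.re + n → DifferentiableAt ℂ (G n) z := by
    intro n z hz
    refine DifferentiableAt.mul ?_ (DifferentiableAt.fun_finsetProd fun j _ => ?_)
    · exact DifferentiableAt.comp (g := f) (f := fun z : ℂ => z + n) z
        (hf _ (by simpa using hz)) (by fun_prop)
    · exact (hh.comp (differentiable_id.add_const (j : ℂ))).differentiableAt
  have hex : ∀ z : ℂ, ∃ n : ℕ, 0 < z.re + n := by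
    intro z
    obtain ⟨n, hn⟩ := exists_nat_gt (-z.re)
    exact ⟨n, by linarith⟩
  choose ν hν using hex
  have hF : ∀ (n : ℕ) (z : ℂ), 0 < z.re + n → G (ν z) z = G n z := by
    intro n z hz
    rw [← hle n (ν z) z hz, ← hle (ν z) n z (hν z), add_comm]
  refine ⟨fun z => G (ν z) z, fun z => ?_, fun z hz => ?_⟩
  · refine (hdiff (ν z) z (hν z)).congr_of_eventuallyEq ?_
    have hopen : IsOpen {w : ℂ | 0 < w.re + ν z} :=
      isOpen_lt continuous_const (continuous_re.add continuous_const)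
    filter_upwards [hopen.mem_nhds (hν z)] with w hw using hF (ν z) w hw
  · exact (hF 0 z (by simpa using hz)).trans (by simp [hG])

theorem eq_of_eqOn_re_pos {f g : ℂ → ℂ} (hf : Differentiable ℂ f) (hg : Differentiable ℂ g)
    (h : ∀ z : ℂ, 0 < z.re → f z = g z) : f = g := by
  refine AnalyticOnNhd.eq_of_eventuallyEq (z₀ := 1) (fun z _ => hf.analyticAt z)
    (fun z _ => hg.analyticAt z) ?_
  filter_upwards [isOpen_re_pos.mem_nhds (show 0 < (1 : ℂ).re by simp)] with z hz using h z hz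

theorem exists_reciprocalGamma (N : ℕ) :
    ∃ F : ℂ → ℂ, Differentiable ℂ F ∧ ∀ z : ℂ, 0 < z.re → F z = exp (-logGamma N z) := by
  induction N with
  | zero =>
    refine ⟨id, differentiable_id, fun z hz => ?_⟩
    rw [exp_neg, exp_logGamma_zero hz, inv_inv, id]
  | succ N ih =>
    obtain ⟨h, hh, hhe⟩ := ih
    refine exists_entire_extension (h := h)
      (fun z hz => (differentiableAt_logGamma (N + 1) hz).neg.cexp) hh fun z hz => ?_
    rw [hhe z hz, logGamma_shift N hz, ← exp_add]
    congr 1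
    ring

/-- The entire function `1 / Γ_N`, with `1 / Γ₀(z) = z`. -/
noncomputable def reciprocalGamma (N : ℕ) : ℂ → ℂ := (exists_reciprocalGamma N).choose

theorem differentiable_reciprocalGamma (N : ℕ) : Differentiable ℂ (reciprocalGamma N) :=
  (exists_reciprocalGamma N).choose_spec.1

theorem reciprocalGamma_of_re_pos (N : ℕ) {z : ℂ} (hz : 0 < z.re) :
    reciprocalGamma N z = exp (-logGamma N z) :=
  (exists_reciprocalGamma N).choose_spec.2 z hz

theorem reciprocalGamma_zero (z : ℂ) : reciprocalGamma 0 z = z := by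
  refine congrFun (eq_of_eqOn_re_pos (differentiable_reciprocalGamma 0) differentiable_id
    fun z hz => ?_) z
  rw [reciprocalGamma_of_re_pos 0 hz, exp_neg, exp_logGamma_zero hz, inv_inv, id]

theorem reciprocalGamma_one (z : ℂ) : reciprocalGamma 1 z = (Gamma z)⁻¹ := by
  refine congrFun (eq_of_eqOn_re_pos (g := fun z => (Gamma z)⁻¹) (differentiable_reciprocalGamma 1)
    differentiable_one_div_Gamma fun z hz => ?_) z
  rw [reciprocalGamma_of_re_pos 1 hz, exp_neg, exp_logGamma_one_eq hz]

theorem reciprocalGamma_succ (N : ℕ) (z : ℂ) :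
    reciprocalGamma (N + 1) z = reciprocalGamma (N + 1) (z + 1) * reciprocalGamma N z := by
  have h1 := differentiable_reciprocalGamma (N + 1)
  have h2 := differentiable_reciprocalGamma N
  refine congrFun (eq_of_eqOn_re_pos
    (g := fun z => reciprocalGamma (N + 1) (z + 1) * reciprocalGamma N z) h1
    ((h1.comp (differentiable_id.add_const 1)).mul h2) fun z hz => ?_) z
  rw [reciprocalGamma_of_re_pos _ hz, reciprocalGamma_of_re_pos _ hz,
    reciprocalGamma_of_re_pos _ (show 0 < (z + 1).re by simp; linarith), logGamma_shift N hz,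
    ← exp_add]
  congr 1
  ring

theorem reciprocalGamma_ne_zero (N : ℕ) {z : ℂ} (hz : ∀ k : ℕ, z ≠ -(k : ℂ)) :
    reciprocalGamma N z ≠ 0 := by
  induction N generalizing z with
  | zero => rw [reciprocalGamma_zero]; simpa using hz 0
  | succ N ih =>
    have key : ∀ (m : ℕ) (w : ℂ), (∀ k : ℕ, w ≠ -(k : ℂ)) → 0 < w.re + m →
        reciprocalGamma (N + 1) w ≠ 0 := by
      intro m
      induction m with
      | zero =>
        intro w _ h
        rw [reciprocalGamma_of_re_pos _ (by simpa using h)]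
        exact exp_ne_zero _
      | succ m ihm =>
        intro w hw h
        rw [reciprocalGamma_succ]
        refine mul_ne_zero (ihm (w + 1) (fun k hk => hw (k + 1) ?_) ?_) (ih hw)
        · push_cast
          linear_combination hk
        · push_cast at h
          simp only [add_re, one_re]
          linarith
    obtain ⟨n, hn⟩ := exists_nat_gt (-z.re)
    exact key n z hz (by linarith)

theorem neg_one_pow_mul_re (m : ℕ) (w : ℂ) : ((-1 : ℂ) ^ m * w).re = (-1 : ℝ) ^ m * w.re := by
  rw [show (-1 : ℂ) ^ m = (((-1 : ℝ) ^ m : ℝ) : ℂ) by push_cast; rfl, re_ofReal_mul]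

theorem inv_reciprocalGamma_ofReal (N : ℕ) {x : ℝ} (hx : 0 < x) :
    (reciprocalGamma N x)⁻¹ = (Real.exp (logGamma N x).re : ℂ) := by
  rw [reciprocalGamma_of_re_pos N (by simpa using hx), exp_neg, inv_inv, ofReal_exp,
    ← logGamma_ofReal N hx]

/-- Existence of the multiple gamma functions. -/
theorem isMultipleGamma_inv_reciprocalGamma :
    IsMultipleGamma fun N z => (reciprocalGamma N z)⁻¹ where
  one := by ext z; rw [reciprocalGamma_one, inv_inv]
  entire_inv N _ := by simpa only [inv_inv] using differentiable_reciprocalGamma N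
  functional_equation N _ z hz := by
    have h := reciprocalGamma_ne_zero N hz
    rw [reciprocalGamma_succ N z]
    field_simp
  map_one N _ := by
    rw [reciprocalGamma_of_re_pos N (by simp), logGamma_one]
    simp
  pos N _ x hx := by
    rw [inv_reciprocalGamma_ofReal N hx, ofReal_im, ofReal_re]
    exact ⟨rfl, Real.exp_pos _⟩
  convexity N _ x hx := by
    have h : (fun y : ℝ => Real.log ((reciprocalGamma N y)⁻¹).re) =ᶠ[𝓝 x]
        fun y : ℝ => (logGamma N y).re := by
      filter_upwards [Ioi_mem_nhds hx] with y hy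
      rw [inv_reciprocalGamma_ofReal N hy, ofReal_re, Real.log_exp]
    rw [h.iteratedDeriv_eq, iteratedDeriv_re (fun _ => differentiableAt_logGamma N) _ hx,
      ← neg_one_pow_mul_re]
    exact iteratedDeriv_logGamma_nonneg N le_rfl hx

/-- Two increasing solutions of `v (x + 1) = v x + w x` differ by a constant if `w` tends to `0`. -/
theorem exists_sub_eq_const {v v' w : ℝ → ℝ} (hv : MonotoneOn v (Ioi 0)) (hv' : MonotoneOn v' (Ioi 0))
    (h : ∀ x : ℝ, 0 < x → v (x + 1) = v x + w x) (h' : ∀ x : ℝ, 0 < x → v' (x + 1) = v' x + w x)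
    (hw : ∀ x : ℝ, 0 < x → Tendsto (fun n : ℕ => w (x + n)) atTop (𝓝 0)) :
    ∃ c : ℝ, ∀ x : ℝ, 0 < x → v x - v' x = c := by
  have hper : PeriodicOnPos (fun x => v x - v' x) := fun x hx => by
    simp only [h x hx, h' x hx]; ring
  have hloc : ∀ x y : ℝ, 0 < x → x ≤ y → y ≤ x + 1 → v y - v' y = v x - v' x := by
    intro x y hx hxy hyx
    have hle : ∀ n : ℕ, |(v y - v' y) - (v x - v' x)| ≤ w (x + n) := by
      intro n
      have hxn : 0 < x + n := by positivity
      have hyn : 0 < y + n := by linarith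
      have e1 : v (x + n) - v' (x + n) = v x - v' x := hper.add_nat hx n
      have e2 : v (y + n) - v' (y + n) = v y - v' y := hper.add_nat (hx.trans_le hxy) n
      have a1 := hv (mem_Ioi.2 hxn) (mem_Ioi.2 hyn) (by linarith)
      have a2 := hv (mem_Ioi.2 hyn) (mem_Ioi.2 (show 0 < x + n + 1 by linarith)) (by linarith)
      have a3 := hv' (mem_Ioi.2 hxn) (mem_Ioi.2 hyn) (by linarith)
      have a4 := hv' (mem_Ioi.2 hyn) (mem_Ioi.2 (show 0 < x + n + 1 by linarith)) (by linarith)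
      rw [h _ hxn] at a2
      rw [h' _ hxn] at a4
      rw [abs_le]
      constructor <;> linarith
    have h0 := ge_of_tendsto' (hw x hx) hle
    have := abs_nonpos_iff.1 h0
    linarith
  have hone : ∀ x : ℝ, 1 ≤ x → v x - v' x = v 1 - v' 1 := by
    intro x hx
    obtain ⟨n, hn⟩ : ∃ n : ℕ, ⌊x⌋₊ = n + 1 :=
      Nat.exists_eq_succ_of_ne_zero (Nat.floor_pos.2 hx).ne'
    have h1 := Nat.floor_le (show 0 ≤ x by linarith)
    have h2 := Nat.lt_floor_add_one x
    rw [hn] at h1 h2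
    push_cast at h1 h2
    have h3 := hper.add_nat (show 0 < x - n by linarith) n
    simp only [sub_add_cancel] at h3
    rw [h3]
    exact hloc 1 (x - n) one_pos (by linarith) (by linarith)
  refine ⟨v 1 - v' 1, fun x hx => ?_⟩
  exact (hper x hx).symm.trans (hone (x + 1) (by linarith))

/-- One step of the uniqueness of the multiple gamma functions, for real logarithms: a solution of
the difference equation of `log Γ_{N + 1}` with the convexity property is `log Γ_{N + 1}`. -/
theorem eq_re_logGamma_of_convexity {N : ℕ} {f : ℝ → ℝ}
    (hf : ∀ x : ℝ, 0 < x → ContDiffAt ℝ ⊤ f x)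
    (hshift : ∀ x : ℝ, 0 < x → f (x + 1) = f x - (logGamma N x).re) (hone : f 1 = 0)
    (hconv : ∀ x : ℝ, 0 < x → 0 ≤ (-1 : ℝ) ^ (N + 2) * iteratedDeriv (N + 2) f x)
    {x : ℝ} (hx : 0 < x) : f x = (logGamma (N + 1) x).re := by
  have hL : ∀ M : ℕ, ∀ z : ℂ, 0 < z.re → DifferentiableAt ℂ (logGamma M) z :=
    fun M _ => differentiableAt_logGamma M
  set g : ℝ → ℝ := fun x => (logGamma (N + 1) x).re with hg
  have hgc : ∀ x : ℝ, 0 < x → ContDiffAt ℝ ⊤ g x := fun x hx => contDiffAt_re (hL _) hx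
  have hgshift : ∀ x : ℝ, 0 < x → g (x + 1) = g x - (logGamma N x).re := by
    intro x hx
    simp only [hg]
    push_cast
    rw [logGamma_shift N (by simpa using hx), sub_re]
  have hgconv : ∀ x : ℝ, 0 < x → 0 ≤ (-1 : ℝ) ^ (N + 2) * iteratedDeriv (N + 2) g x := by
    intro x hx
    rw [iteratedDeriv_re (hL _) _ hx, ← neg_one_pow_mul_re]
    exact iteratedDeriv_logGamma_nonneg (N + 1) le_rfl hx
  have hmono : ∀ u : ℝ → ℝ, (∀ x : ℝ, 0 < x → ContDiffAt ℝ ⊤ u x) →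
      (∀ x : ℝ, 0 < x → 0 ≤ (-1 : ℝ) ^ (N + 2) * iteratedDeriv (N + 2) u x) →
      MonotoneOn (fun x => (-1 : ℝ) ^ (N + 2) * iteratedDeriv (N + 1) u x) (Ioi 0) := by
    intro u hu hu2
    have hd : ∀ x : ℝ, 0 < x → HasDerivAt (fun x => (-1 : ℝ) ^ (N + 2) * iteratedDeriv (N + 1) u x)
        ((-1 : ℝ) ^ (N + 2) * iteratedDeriv (N + 2) u x) x := by
      intro x hx
      rw [iteratedDeriv_succ (n := N + 1)]
      exact (differentiableAt_iteratedDeriv (hu x hx) (N + 1)).hasDerivAt.const_mul _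
    refine monotoneOn_of_deriv_nonneg (convex_Ioi 0)
      (fun x hx => (hd x hx).continuousAt.continuousWithinAt) ?_ ?_ <;> rw [interior_Ioi]
    · exact fun x hx => (hd x hx).differentiableAt.differentiableWithinAt
    · intro x hx
      rw [(hd x hx).deriv]
      exact hu2 x hx
  have hstep : ∀ u : ℝ → ℝ, (∀ x : ℝ, 0 < x → ContDiffAt ℝ ⊤ u x) →
      (∀ x : ℝ, 0 < x → u (x + 1) = u x - (logGamma N x).re) → ∀ x : ℝ, 0 < x →
      (-1 : ℝ) ^ (N + 2) * iteratedDeriv (N + 1) u (x + 1) =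
        (-1 : ℝ) ^ (N + 2) * iteratedDeriv (N + 1) u x +
        (-1 : ℝ) ^ (N + 1) * (iteratedDeriv (N + 1) (logGamma N) x).re := by
    intro u hu hus x hx
    have h1 : iteratedDeriv (N + 1) u (x + 1) = iteratedDeriv (N + 1) u x -
        iteratedDeriv (N + 1) (fun y : ℝ => (logGamma N y).re) x := by
      rw [← iteratedDeriv_fun_sub ((hu x hx).of_le le_top)
        ((contDiffAt_re (hL N) hx)), ← congrFun (iteratedDeriv_comp_add_const (N + 1) u 1) x]
      refine Filter.EventuallyEq.iteratedDeriv_eq _ ?_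
      filter_upwards [Ioi_mem_nhds hx] with y hy using hus y hy
    rw [h1, iteratedDeriv_re (hL N) _ hx, pow_succ (-1 : ℝ) (N + 1)]
    ring
  obtain ⟨c, hc⟩ := exists_sub_eq_const (hmono f hf hconv) (hmono g hgc hgconv) (hstep f hf hshift)
    (hstep g hgc hgshift) (fun x hx => by
      have h1 := (tendsto_iteratedDeriv_logGamma_add_nat (le_refl (N + 1)) x).const_mul
        ((-1 : ℂ) ^ (N + 1))
      rw [mul_zero] at h1
      refine ((continuous_re.tendsto' 0 0 rfl).comp h1).congr fun n => ?_
      rw [Function.comp_apply, neg_one_pow_mul_re]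
      push_cast
      rfl)
  have hper : PeriodicOnPos (fun x => f x - g x) := by
    intro x hx
    simp only [hshift x hx, hgshift x hx]
    ring
  obtain ⟨c', hc'⟩ := hper.const_of_iteratedDeriv_const (fun x hx => (hf x hx).sub (hgc x hx)) (N + 1)
    (c := (-1 : ℝ) ^ (N + 2) * c) (fun x hx => by
      rw [iteratedDeriv_fun_sub ((hf x hx).of_le le_top) ((hgc x hx).of_le le_top), ← hc x hx,
        ← mul_sub, ← mul_assoc, ← mul_pow]
      simp)
  have h1 := hc' 1 one_pos
  have h2 := hc' x hx
  simp only [hone, hg, ofReal_one, logGamma_one, zero_re, sub_zero] at h1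
  rw [← h1] at h2
  linarith

/-- Uniqueness of the multiple gamma functions. -/
theorem IsMultipleGamma.eq_inv_reciprocalGamma {Γ : ℕ → ℂ → ℂ} (h : IsMultipleGamma Γ) {m : ℕ}
    (hm : 1 ≤ m) : Γ m = fun z => (reciprocalGamma m z)⁻¹ := by
  induction m, hm using Nat.le_induction with
  | base => rw [h.one]; ext z; rw [reciprocalGamma_one, inv_inv]
  | succ N hN ih =>
    have hN1 : 1 ≤ N + 1 := by lia
    have hre : ∀ x : ℝ, 0 < x → Γ (N + 1) x = ((Γ (N + 1) x).re : ℂ) := fun x hx =>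
      Complex.ext (by simp) (by simp [(h.pos (N + 1) hN1 x hx).1])
    have hlog : ∀ x : ℝ, 0 < x → Real.log (Γ (N + 1) x).re = (logGamma (N + 1) x).re := by
      intro x hx
      refine eq_re_logGamma_of_convexity (f := fun y : ℝ => Real.log (Γ (N + 1) y).re) ?_ ?_ ?_ ?_ hx
      · intro y hy
        have hy2 := (h.pos (N + 1) hN1 y hy).2
        have h1 : ContDiffAt ℂ ⊤ (fun z => (Γ (N + 1) z)⁻¹) y :=
          ((h.entire_inv (N + 1) hN1).analyticAt _).contDiffAt
        have h2 : ContDiffAt ℂ ⊤ (Γ (N + 1)) y := by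
          have h3 : Γ (N + 1) y ≠ 0 := by
            intro h0; rw [h0] at hy2; simp at hy2
          exact (h1.inv (inv_ne_zero h3)).congr_of_eventuallyEq
            (Eventually.of_forall fun z => by simp)
        exact h2.real_of_complex.log hy2.ne'
      · intro y hy
        have hfe := h.functional_equation N hN y (fun k hk => by
          have := congrArg re hk
          simp at this
          linarith [k.cast_nonneg (α := ℝ)])
        have hpos := (h.pos (N + 1) hN1 y hy).2
        rw [hre y hy, (congrFun ih y).trans (inv_reciprocalGamma_ofReal N hy),
          ← ofReal_div] at hfe
        push_cast
        rw [hfe, ofReal_re, Real.log_div hpos.ne' (Real.exp_pos _).ne', Real.log_exp]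
      · simp [h.map_one (N + 1) hN1]
      · exact fun y hy => h.convexity (N + 1) hN1 y hy
    have hinv : (fun z => (Γ (N + 1) z)⁻¹) = reciprocalGamma (N + 1) := by
      refine eq_of_eqOn_re_pos (h.entire_inv (N + 1) hN1) (differentiable_reciprocalGamma (N + 1)) ?_
      refine fun z hz => eqOn_re_pos_of_forall_ofReal (h.entire_inv (N + 1) hN1).differentiableOn
        (differentiable_reciprocalGamma (N + 1)).differentiableOn (fun x hx => ?_) hz
      rw [← inv_inj, inv_inv, inv_reciprocalGamma_ofReal (N + 1) hx, ← hlog x hx,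
        Real.exp_log (h.pos (N + 1) hN1 x hx).2, ← hre x hx]
    ext z
    rw [← hinv, inv_inv]

theorem isMultipleGamma_multipleGamma : IsMultipleGamma multipleGamma :=
  Classical.epsilon_spec ⟨_, isMultipleGamma_inv_reciprocalGamma⟩

theorem multipleGamma_of_re_pos {N : ℕ} (hN : 1 ≤ N) {z : ℂ} (hz : 0 < z.re) :
    multipleGamma N z = exp (logGamma N z) := by
  rw [congrFun (isMultipleGamma_multipleGamma.eq_inv_reciprocalGamma hN) z,
    reciprocalGamma_of_re_pos N hz, exp_neg, inv_inv]

theorem logDeriv_multipleGamma {N : ℕ} (hN : 1 ≤ N) {z : ℂ} (hz : 0 < z.re) :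
    logDeriv (multipleGamma N) z = deriv (logGamma N) z := by
  have h : multipleGamma N =ᶠ[𝓝 z] fun z => exp (logGamma N z) := by
    filter_upwards [isOpen_re_pos.mem_nhds hz] with w hw using multipleGamma_of_re_pos hN hw
  rw [logDeriv_apply, h.deriv_eq, multipleGamma_of_re_pos hN hz,
    (differentiableAt_logGamma N hz).hasDerivAt.cexp.deriv]
  field_simp [exp_ne_zero]

/-- The branch of `log Γ_N` defined by integrating the logarithmic derivative is `logGamma N`. -/
theorem logMultipleGamma_eq {N : ℕ} (hN : 1 ≤ N) {w : ℂ} (hw : 0 < w.re) :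
    logMultipleGamma N w = logGamma N w := by
  have hpos : ∀ t ∈ uIcc (0 : ℝ) 1, 0 < (1 + (t : ℂ) * (w - 1)).re := by
    intro t ht
    rw [uIcc_of_le zero_le_one] at ht
    have : (1 + (t : ℂ) * (w - 1)).re = (1 - t) + t * w.re := by simp; ring
    rw [this]
    rcases ht.1.eq_or_lt with h0 | h0
    · rw [← h0]; norm_num
    · nlinarith [ht.2, mul_pos h0 hw]
  have hcongr : logMultipleGamma N w =
      ∫ t in (0 : ℝ)..1, deriv (logGamma N) (1 + (t : ℂ) * (w - 1)) * (w - 1) := by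
    refine intervalIntegral.integral_congr fun t ht => ?_
    rw [logDeriv_multipleGamma hN (hpos t ht), mul_comm]
  have hderiv : ∀ t ∈ uIcc (0 : ℝ) 1, HasDerivAt (fun t : ℝ => logGamma N (1 + (t : ℂ) * (w - 1)))
      (deriv (logGamma N) (1 + (t : ℂ) * (w - 1)) * (w - 1)) t := by
    intro t ht
    have h1 : HasDerivAt (fun t : ℂ => 1 + t * (w - 1)) (w - 1) (t : ℂ) := by
      simpa using ((hasDerivAt_id (t : ℂ)).mul_const (w - 1)).const_add 1
    exact ((differentiableAt_logGamma N (hpos t ht)).hasDerivAt.comp (t : ℂ) h1).comp_ofReal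
  have hcont : ContinuousOn (fun t : ℝ => deriv (logGamma N) (1 + (t : ℂ) * (w - 1)) * (w - 1))
      (uIcc 0 1) := by
    intro t ht
    have h1 : ContinuousAt (deriv (logGamma N)) (1 + (t : ℂ) * (w - 1)) := by
      have h2 := differentiableAt_iteratedDeriv (contDiffAt_of_re_pos
        (fun _ => differentiableAt_logGamma N) (hpos t ht)) 1
      rw [iteratedDeriv_one] at h2
      exact h2.continuousAt
    refine ContinuousAt.continuousWithinAt (ContinuousAt.mul ?_ continuousAt_const)
    exact ContinuousAt.comp (f := fun t : ℝ => 1 + (t : ℂ) * (w - 1)) h1 (by fun_prop)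
  rw [hcongr, intervalIntegral.integral_eq_sub_of_hasDerivAt hderiv hcont.intervalIntegrable]
  simp [logGamma_one]

/-! ### The integral representations -/

theorem exp_log_of_re_pos {a : ℂ} (ha : 0 < a.re) : exp (log a) = a :=
  exp_log fun h => by simp [h] at ha

theorem abs_im_log_lt {a : ℂ} (ha : 0 < a.re) : |(log a).im| < Real.pi / 2 := by
  rw [log_im, abs_arg_lt_pi_div_two_iff]
  exact Or.inl ha

theorem log_mul_of_re_pos {a b : ℂ} (ha : 0 < a.re) (hb : 0 < b.re) :
    log (a * b) = log a + log b := by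
  have h1 := abs_lt.1 (abs_im_log_lt ha)
  have h2 := abs_lt.1 (abs_im_log_lt hb)
  rw [← log_exp (x := log a + log b) (by rw [add_im]; linarith) (by rw [add_im]; linarith), exp_add,
    exp_log_of_re_pos ha, exp_log_of_re_pos hb]

theorem log_div_of_re_pos {a b : ℂ} (ha : 0 < a.re) (hb : 0 < b.re) :
    log (a / b) = log a - log b := by
  have h1 := abs_lt.1 (abs_im_log_lt ha)
  have h2 := abs_lt.1 (abs_im_log_lt hb)
  rw [← log_exp (x := log a - log b) (by rw [sub_im]; linarith) (by rw [sub_im]; linarith), exp_sub,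
    exp_log_of_re_pos ha, exp_log_of_re_pos hb]

theorem log_add_log_eq {z : ℂ} (hz : 0 < z.re) (x : ℝ) :
    log (z + I * x) + log (z + -(I * x)) = log ((x : ℂ) ^ 2 + z ^ 2) := by
  rw [← log_mul_of_re_pos (by simpa using hz) (by simpa using hz)]
  congr 1
  linear_combination -(x : ℂ) ^ 2 * I_sq

theorem log_sub_log_eq {z : ℂ} (hz : 0 < z.re) (x : ℝ) :
    log (z + I * x) - log (z + -(I * x)) = 2 * I * arctan ((x : ℂ) / z) := by
  have hz0 : z ≠ 0 := fun h => by simp [h] at hz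
  have hb : z + -(I * x) ≠ 0 := fun h => by
    have := congrArg re h
    simp at this
    linarith
  have h : (1 + (x : ℂ) / z * I) / (1 - (x : ℂ) / z * I) = (z + I * x) / (z + -(I * x)) := by
    have h1 : 1 + (x : ℂ) / z * I = (z + I * x) / z := by field_simp
    have h2 : 1 - (x : ℂ) / z * I = (z + -(I * x)) / z := by field_simp; ring
    rw [h1, h2, div_div_div_cancel_right₀ hz0]
  rw [arctan, h, log_div_of_re_pos (by simpa using hz) (by simpa using hz)]
  linear_combination (log (z + I * x) - log (z + -(I * x))) * I_sq

theorem integrableOn_planaIntegrand_log {p : ℕ} (hp : 1 ≤ p) {z : ℂ} (hz : 0 < z.re) :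
    IntegrableOn (planaIntegrand p fun w => log (z + w)) (Ioi 0) :=
  integrableOn_planaIntegrand hp (fun x => continuousAt_log_add hz x)
    (fun x => norm_log_add_I_mul_le hz x)

theorem planaIntegrand_log_even {n : ℕ} {z : ℂ} (hz : 0 < z.re) (x : ℝ) :
    planaIntegrand (2 * n) (fun w => log (z + w)) x = 2 * I * (-1) ^ n *
      ((x : ℂ) ^ (2 * n) * arctan ((x : ℂ) / z) / (exp (2 * (Real.pi : ℂ) * (x : ℂ)) - 1)) := by
  have h : (I * (x : ℂ)) ^ (2 * n) = (-1) ^ n * (x : ℂ) ^ (2 * n) := by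
    rw [mul_pow, pow_mul I, I_sq]
  rw [planaIntegrand, (even_two_mul n).neg_pow, ← mul_sub, log_sub_log_eq hz, h]
  ring

theorem planaIntegrand_log_odd {n p : ℕ} (hp : p + 1 = 2 * n) {z : ℂ} (hz : 0 < z.re) (x : ℝ) :
    planaIntegrand p (fun w => log (z + w)) x = -I * (-1) ^ n *
      ((x : ℂ) ^ p * log ((x : ℂ) ^ 2 + z ^ 2) / (exp (2 * (Real.pi : ℂ) * (x : ℂ)) - 1)) := by
  have hodd : Odd p := by
    rw [← Nat.not_even_iff_odd]
    intro h
    rw [Nat.even_iff] at h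
    lia
  have hI : I ^ p = -I * (-1) ^ n := by
    have h : I ^ (p + 1) = (-1) ^ n := by rw [hp, pow_mul, I_sq]
    rw [← h, pow_succ]
    linear_combination I ^ p * I_sq
  rw [planaIntegrand, hodd.neg_pow, neg_mul, sub_neg_eq_add, ← mul_add, log_add_log_eq hz, mul_pow, hI]
  ring

/-- The values of `log Γ_{k + 1} (z + 1)`, `k ≤ p`, combine to a regularized sum; the term of `k = p`
is isolated. -/
theorem normalizedLogSum_eq_logMultipleGamma {p : ℕ} (hp : 1 ≤ p) {z : ℂ} (hz : 0 < z.re) :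
    normalizedLogSum p z = (∑ k ∈ Finset.Icc 1 (p - 1),
      (-1 : ℂ) ^ k * (Nat.factorial k : ℂ) * (Nat.stirlingSecond p k : ℂ) *
        logMultipleGamma (k + 1) (z + 1)) +
      (-1) ^ p * (Nat.factorial p : ℂ) * logMultipleGamma (p + 1) (z + 1) := by
  have hlog : ∀ k : ℕ, chooseLogSum k z = logMultipleGamma (k + 1) (z + 1) := fun k => by
    rw [logMultipleGamma_eq (by lia) (by simp; linarith), logGamma_succ_add_one k hz]
  obtain ⟨q, rfl⟩ : ∃ q, p = q + 1 := ⟨p - 1, by lia⟩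
  rw [normalizedLogSum_eq_sum_chooseLogSum, Finset.sum_range_succ, Finset.sum_range_succ',
    Nat.stirlingSecond_self, Nat.stirlingSecond_succ_zero, Nat.add_sub_cancel,
    ← Finset.Ico_add_one_right_eq_Icc, Finset.sum_Ico_eq_sum_range]
  simp [hlog, add_comm]

theorem zetaCorrection_eq_sum_Icc (p : ℕ) (z : ℂ) :
    zetaCorrection p z = -∑ k ∈ Finset.Icc 0 p, (-1 : ℂ) ^ k * (p.choose k : ℂ) *
      deriv riemannZeta (-(k : ℂ)) * z ^ (p - k) := by
  rw [zetaCorrection, Nat.range_succ_eq_Icc_zero]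

theorem proposition3p1 :
    -- the system has a solution, namely `multipleGamma`, and only one
    (IsMultipleGamma multipleGamma ∧
      ∀ Γ : ℕ → ℂ → ℂ, IsMultipleGamma Γ → ∀ m : ℕ, 1 ≤ m → Γ m = multipleGamma m) ∧
    ∀ (n : ℕ), 1 ≤ n → ∀ (z : ℂ), 0 < z.re →
      -- the representation of `(2n)! log Γ_{2n+1}(z+1)`, with its convergent integral
      (MeasureTheory.IntegrableOn
          (fun x : ℝ => (x : ℂ) ^ (2 * n) * Complex.arctan ((x : ℂ) / z) /
            (Complex.exp (2 * (Real.pi : ℂ) * (x : ℂ)) - 1)) (Set.Ioi 0) ∧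
        (Nat.factorial (2 * n) : ℂ) * logMultipleGamma (2 * n + 1) (z + 1) =
          z ^ (2 * n + 1) * (Complex.log z - ((harmonic (2 * n + 1) : ℚ) : ℂ)) / (2 * (n : ℂ) + 1)
          - ∑ k ∈ Finset.Icc 0 (2 * n),
              (-1 : ℂ) ^ k * (Nat.choose (2 * n) k : ℂ) * deriv riemannZeta (-(k : ℂ)) *
                z ^ (2 * n - k)
          - ∑ k ∈ Finset.Icc 1 (2 * n - 1),
              (-1 : ℂ) ^ k * (Nat.factorial k : ℂ) * (Nat.stirlingSecond (2 * n) k : ℂ) *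
                logMultipleGamma (k + 1) (z + 1)
          + 2 * (-1 : ℂ) ^ n *
              ∫ x in Set.Ioi (0 : ℝ), (x : ℂ) ^ (2 * n) * Complex.arctan ((x : ℂ) / z) /
                (Complex.exp (2 * (Real.pi : ℂ) * (x : ℂ)) - 1)) ∧
      -- the representation of `(2n-1)! log Γ_{2n}(z+1)`, with its convergent integral
      (MeasureTheory.IntegrableOn
          (fun x : ℝ => (x : ℂ) ^ (2 * n - 1) * Complex.log ((x : ℂ) ^ 2 + z ^ 2) /
            (Complex.exp (2 * (Real.pi : ℂ) * (x : ℂ)) - 1)) (Set.Ioi 0) ∧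
        (Nat.factorial (2 * n - 1) : ℂ) * logMultipleGamma (2 * n) (z + 1) =
          -(z ^ (2 * n) * (Complex.log z - ((harmonic (2 * n) : ℚ) : ℂ)) / (2 * (n : ℂ)))
          + ∑ k ∈ Finset.Icc 0 (2 * n - 1),
              (-1 : ℂ) ^ k * (Nat.choose (2 * n - 1) k : ℂ) * deriv riemannZeta (-(k : ℂ)) *
                z ^ (2 * n - k - 1)
          + ∑ k ∈ Finset.Icc 1 (2 * n - 2),
              (-1 : ℂ) ^ k * (Nat.factorial k : ℂ) * (Nat.stirlingSecond (2 * n - 1) k : ℂ) *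
                logMultipleGamma (k + 1) (z + 1)
          - (-1 : ℂ) ^ n *
              ∫ x in Set.Ioi (0 : ℝ), (x : ℂ) ^ (2 * n - 1) * Complex.log ((x : ℂ) ^ 2 + z ^ 2) /
                (Complex.exp (2 * (Real.pi : ℂ) * (x : ℂ)) - 1)) := by
  refine ⟨⟨isMultipleGamma_multipleGamma, fun Γ h m hm => (h.eq_inv_reciprocalGamma hm).trans
    (isMultipleGamma_multipleGamma.eq_inv_reciprocalGamma hm).symm⟩, fun n hn z hz => ⟨?_, ?_⟩⟩
  · have hp : 1 ≤ 2 * n := by lia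
    have hc : (2 * I * (-1) ^ n : ℂ) ≠ 0 := by simp
    have hint := integrableOn_planaIntegrand_log hp hz
    rw [show planaIntegrand (2 * n) (fun w => log (z + w)) = _ from
      funext (planaIntegrand_log_even hz)] at hint
    refine ⟨(integrable_const_mul_iff hc.isUnit _).1 hint, ?_⟩
    have h := normalizedLogSum_eq_logMultipleGamma hp hz
    rw [normalizedLogSum, zetaCorrection_eq_sum_Icc, logSum, logSumRemainder, if_neg (by lia),
      planaIntegral, integral_congr_ae (Eventually.of_forall (planaIntegrand_log_even hz)),
      integral_const_mul, pow_succ (-1 : ℂ) (2 * n), (even_two_mul n).neg_one_pow] at h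
    push_cast at h
    linear_combination -h - 2 * (-1) ^ n * (∫ x in Ioi (0 : ℝ), (x : ℂ) ^ (2 * n) *
      arctan ((x : ℂ) / z) / (exp (2 * (Real.pi : ℂ) * (x : ℂ)) - 1)) * I_sq
  · obtain ⟨p, hp⟩ : ∃ p, p + 1 = 2 * n := ⟨2 * n - 1, by lia⟩
    have hp1 : 1 ≤ p := by lia
    have hodd : Odd p := by
      rw [← Nat.not_even_iff_odd, Nat.even_iff]
      lia
    have hexp : ∀ k : ℕ, 2 * n - k - 1 = p - k := fun k => by lia
    have hc : (-I * (-1) ^ n : ℂ) ≠ 0 := by simp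
    have hint := integrableOn_planaIntegrand_log hp1 hz
    rw [show planaIntegrand p (fun w => log (z + w)) = _ from
      funext (planaIntegrand_log_odd hp hz)] at hint
    rw [show 2 * n - 1 = p by lia, show 2 * n - 2 = p - 1 by lia]
    simp only [hexp]
    refine ⟨(integrable_const_mul_iff hc.isUnit _).1 hint, ?_⟩
    have h := normalizedLogSum_eq_logMultipleGamma hp1 hz
    rw [normalizedLogSum, zetaCorrection_eq_sum_Icc, logSum, logSumRemainder, if_neg (by lia),
      planaIntegral, integral_congr_ae (Eventually.of_forall (planaIntegrand_log_odd hp hz)),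
      integral_const_mul, pow_succ (-1 : ℂ) p, hodd.neg_one_pow,
      show (p : ℂ) + 1 = 2 * n by exact_mod_cast hp, hp] at h
    linear_combination h + (-1) ^ n * (∫ x in Ioi (0 : ℝ), (x : ℂ) ^ p *
      log ((x : ℂ) ^ 2 + z ^ 2) / (exp (2 * (Real.pi : ℂ) * (x : ℂ)) - 1)) * I_sq
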